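/- For $b>0$ let $\Phi_b$ be the non-compact quantum dilogarithm: the meromorphic function on $\mathbb C$ (with removable singularities removed) given in the strip $|\mathrm{Im}\,x|<\tfrac12(b+b^{-1})$ by $$\Phi_b(x)=\exp\left(\int_{\mathbb R+i0}\frac{e^{-2ixt}}{4\sinh(bt)\sinh(b^{-1}t)}\frac{dt}{t}\right).$$ Let $N\ge 1$ be an integer, $s=\sqrt N$, $b=1/\sqrt N$, $Q=b+b^{-1}$ and $q=e^{\pi i b^2}=e^{\pi i/N}$, and let $$D_N(x;q):=\prod_{k=1}^{N-1}(1-q^kx)^{k/N},\qquad \mathrm{Li}_2(u):=-\int_0^1\frac{\log(1-tu)}{t}\,dt,$$ where logarithms and powers are principal ($-\pi<\arg\le\pi$). Then the following hold. (i) For all $z\in\mathbb C$ with $e^{2\pi sz}\ne 1$, $$\Phi_{1/\sqrt N}\left(z-\frac{iQ}2\right)=\frac{e^{\frac{i}{2\pi s^2}\mathrm{Li}_2(e^{2\pi sz})}\,(1-e^{2\pi sz})^{1+\frac{iz}{s}}}{D_N(e^{2\pi sz/N};q^2)}.$$ (ii) Let $\Omega$ be $\mathbb C$ without the rays $[0,\infty)+in$,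 $n\in\mathbb Z\setminus\{0\}$. On $\Omega$ the function $\Phi_1$ has a holomorphic logarithm, $\log\Phi_1$, which for $|\mathrm{Im}\,w|<1$ equals the integral that defines $\Phi_1(w)$. With $\Phi_1(w)^{1/s^2}:=\exp\left(\tfrac1{s^2}\log\Phi_1(w)\right)$, for all $z$ with $sz\in\Omega$ (in particular for all real $z$), $$\Phi_{1/\sqrt N}\left(z-\frac{iQ}2\right)=\frac{(1-e^{2\pi sz})\,\Phi_1(sz)^{1/s^2}}{D_N(e^{2\pi sz/N};q^2)}.$$ -/

import Mathlib

/-- The integrand `e^{-2ixt} / (4 sinh(bt) sinh(b⁻¹t) t)`. -/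
noncomputable def qdilogIntegrand (b x t : ℂ) : ℂ :=
  Complex.exp (-2 * Complex.I * x * t) /
    (4 * Complex.sinh (b * t) * Complex.sinh (b⁻¹ * t)) / t

/-- The integral over the contour `ℝ + i0`: the limit, as `ε` decreases to `0`, of the integral
over the horizontal line `ℝ + iε`. -/
noncomputable def qdilogExponent (b x : ℂ) : ℂ :=
  Filter.limUnder (nhdsWithin (0 : ℝ) (Set.Ioi 0))
    (fun ε : ℝ => ∫ t : ℝ, qdilogIntegrand b x ((t : ℂ) + (ε : ℂ) * Complex.I))

/-- The strip `|Im x| < |Im (i (b + b⁻¹) / 2)|`. -/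
def qdilogStrip (b : ℂ) : Set ℂ :=
  {x : ℂ | |x.im| < |(Complex.I * (b + b⁻¹) / 2).im|}

/-- `F` is the meromorphic continuation to `ℂ` of the function given by the integral in the strip.
Normal form means that `F` takes its continuous value wherever it has one; so there is
at most one such `F` when the strip is non-empty. -/
def IsQDilogContinuation (b : ℂ) (F : ℂ → ℂ) : Prop :=
  MeromorphicNFOn F Set.univ ∧ ∀ x ∈ qdilogStrip b, F x = Complex.exp (qdilogExponent b x)

open Classical in
/-- The non-compact quantum dilogarithm `Φ_b`: the integral in the strip, continued
meromorphically to the whole plane. -/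
noncomputable def qdilog (b : ℂ) : ℂ → ℂ :=
  if h : ∃ F : ℂ → ℂ, IsQDilogContinuation b F then h.choose
  else fun x => Complex.exp (qdilogExponent b x)

/-- The dilogarithm `Li₂(u) = -∫₀¹ log(1 - tu) dt/t` (principal logarithm). -/
noncomputable def dilog (u : ℂ) : ℂ :=
  -∫ t in (0 : ℝ)..1, Complex.log (1 - (t : ℂ) * u) / (t : ℂ)

/-- The cyclic dilogarithm `D_N(x; q) = ∏_{k=1}^{N-1} (1 - q^k x)^{k/N}` (principal powers). -/
noncomputable def cyclicDilog (N : ℕ) (x q : ℂ) : ℂ :=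
  ∏ k ∈ Finset.Icc 1 (N - 1), (1 - q ^ k * x) ^ ((k : ℂ) / (N : ℂ))

/-- The plane without the rays `[0, ∞) + in`, for non-zero integers `n`. -/
def slitPlaneOne : Set ℂ :=
  {w : ℂ | ∀ n : ℤ, n ≠ 0 → 0 ≤ w.re → w.im ≠ (n : ℝ)}

/-- `L` is the holomorphic branch of `log Φ_1` on `slitPlaneOne` which in the strip `|Im w| < 1`
is the integral that defines `Φ_1`. As `slitPlaneOne` is open and connected, `L` is
unique there. -/
structure IsLogQDilogOne (L : ℂ → ℂ) : Prop where
  differentiableOn : DifferentiableOn ℂ L slitPlaneOne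
  exp_eq : ∀ w ∈ slitPlaneOne, Complex.exp (L w) = qdilog 1 w
  eq_exponent : ∀ w ∈ qdilogStrip 1, L w = qdilogExponent 1 w

/-!
For `b = 1 / √N` everything reduces to `Φ₁`. After the substitution `t = τ / √N` the kernel of the
integral becomes `1 / (sinh (τ / N) sinh τ)`. Since `sinh τ / sinh (τ / N)` is the sum of the
exponentials `e^{(N - 1 - 2j)τ/N}`, `0 ≤ j < N`, the exponent splits into `N` exponents with `b = 1`
(`qdilogExponent_eq_sum`), so that `Φ_{1/√N}(x) = ∏ Φ₁(x / √N + i (N - 1 - 2j) / 2N)`.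

For `b = 1` the integral can be moved to the line `Im t = π / 2`
(`integral_qdilogIntegrand_one`). Its derivative in `w` is then a Fourier transform of `1 / cosh²`,
which is a Beta integral, and equals `-2πi w e^{2πw} / (1 - e^{2πw})`. The function
`ℓ(w) = (i / 2π) Li₂(e^{2πw}) + i w log (1 - e^{2πw})` has the same derivative away from the rays
`[0, ∞) + in`. Both functions tend to zero as `Re w → -∞`, hence they agree
(`logQDilogOne_eq_dilogLogQDilogOne`). Because `ℓ(w) = ℓ(w - in) - n log (1 - e^{2πw})`, the values
in the strip translated by `in` and multiplied by `(1 - e^{2πw})⁻ⁿ` fit together to the meromorphic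
continuation of `Φ₁` (`qdilogOne`), whose exact poles and zeros can be read off. A meromorphic
function in normal form is determined by its values in the strip, so this continuation computes
`qdilog` (`qdilog_eq_of_meromorphic`).

With `w = √N z` the product formula at `z - iQ / 2` has the factors `Φ₁((w + ik) / N - i)`,
`0 ≤ k < N`, and `e^{2π(w + ik)/N}` runs through the `N`-th roots of `e^{2πw}`. Off the cuts the
distribution relations of `log (1 - u)` and `Li₂` evaluate the sum of the values of `ℓ`
(`sum_dilogLogQDilogOne_cyclicNode`); the terms `-k / N` coming from `i (w + ik) / N` produce
the cyclic dilogarithm. On a cut both sides are limits from below, where every principal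
logarithm, and the dilogarithm, is continuous (`prod_qdilogOne_eq_of_tendsto`).
-/

open Filter Topology MeasureTheory Set Complex

/-! ### Holomorphic integrals over horizontal lines and the kernel `1 / sinh²` -/

theorem integrable_exp_neg_mul_abs {c : ℝ} (hc : 0 < c) :
    Integrable (fun t : ℝ => Real.exp (-c * |t|)) := by
  rw [← integrableOn_univ, ← Iic_union_Ioi (a := (0 : ℝ)), integrableOn_union]
  constructor
  · refine (integrableOn_exp_mul_Iic hc 0).congr_fun (fun t ht => ?_) measurableSet_Iic
    simp [abs_of_nonpos (mem_Iic.1 ht)]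
  · refine (exp_neg_integrableOn_Ioi 0 hc).congr_fun (fun t ht => ?_) measurableSet_Ioi
    simp [abs_of_pos (mem_Ioi.1 ht)]

/-- The integral of a holomorphic function over a horizontal line does not change when the line is
moved through a strip in which the function decays exponentially. -/
theorem integral_horizontal_line_eq {f : ℂ → ℂ} {a b C c : ℝ} (hc : 0 < c)
    (hf : DifferentiableOn ℂ f {t | t.im ∈ uIcc a b})
    (hb : ∀ x : ℝ, ∀ y ∈ uIcc a b, ‖f (x + y * I)‖ ≤ C * Real.exp (-c * |x|)) :
    ∫ x : ℝ, f (x + a * I) = ∫ x : ℝ, f (x + b * I) := by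
  have hint : ∀ y ∈ uIcc a b, Integrable (fun x : ℝ => f (x + y * I)) := by
    intro y hy
    refine ((integrable_exp_neg_mul_abs hc).const_mul C).mono' ?_ (ae_of_all _ fun x => hb x y hy)
    refine Continuous.aestronglyMeasurable ?_
    refine hf.continuousOn.comp_continuous (by fun_prop) fun x => by simpa using hy
  have hside : ∀ ε : ℝ, |ε| = 1 → Tendsto (fun T : ℝ => ∫ y : ℝ in a..b, f ((ε * T : ℝ) + y * I))
      atTop (𝓝 0) := by
    intro ε hε
    have h0 : Tendsto (fun T : ℝ => C * Real.exp (-c * T) * |b - a|) atTop (𝓝 0) := by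
      have : Tendsto (fun T : ℝ => Real.exp (-c * T)) atTop (𝓝 0) :=
        Real.tendsto_exp_atBot.comp (tendsto_id.const_mul_atTop_of_neg (by linarith))
      simpa using (this.const_mul C).mul_const |b - a|
    refine squeeze_zero_norm' ?_ h0
    filter_upwards [eventually_ge_atTop 0] with T hT
    refine intervalIntegral.norm_integral_le_of_norm_le_const fun y hy => ?_
    have := hb (ε * T) y (uIoc_subset_uIcc hy)
    rwa [abs_mul, hε, one_mul, abs_of_nonneg hT] at this
  have hlim : ∀ y ∈ uIcc a b, Tendsto (fun T : ℝ => ∫ x : ℝ in (-T)..T, f (x + y * I)) atTop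
      (𝓝 (∫ x : ℝ, f (x + y * I))) := fun y hy =>
    intervalIntegral_tendsto_integral (hint y hy) tendsto_neg_atTop_atBot tendsto_id
  have hrect : ∀ T : ℝ, (∫ x : ℝ in (-T)..T, f (x + a * I)) - (∫ x : ℝ in (-T)..T, f (x + b * I)) +
      I • (∫ y : ℝ in a..b, f ((1 * T : ℝ) + y * I)) -
      I • (∫ y : ℝ in a..b, f ((-1 * T : ℝ) + y * I)) = 0 := by
    intro T
    have := integral_boundary_rect_eq_zero_of_differentiableOn f (-T + a * I) (T + b * I)
      (hf.mono fun t ht => by simpa [mem_reProdIm] using ht.2)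
    simpa using this
  have := (((hlim a left_mem_uIcc).sub (hlim b right_mem_uIcc)).add
    ((hside 1 (by simp)).const_smul I)).sub ((hside (-1) (by simp)).const_smul I)
  simp only [hrect] at this
  have h2 := tendsto_nhds_unique this tendsto_const_nhds
  simpa [sub_eq_zero] using h2

theorem norm_sinh_sq_ge (x y : ℝ) :
    Real.sin y ^ 2 * Real.cosh x ^ 2 ≤ ‖Complex.sinh (x + y * I)‖ ^ 2 := by
  have h : Complex.sinh (x + y * I) = ((Real.sinh x * Real.cos y : ℝ) : ℂ) +
      ((Real.cosh x * Real.sin y : ℝ) : ℂ) * I := by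
    rw [Complex.sinh_add, Complex.sinh_mul_I, Complex.cosh_mul_I]; push_cast; ring
  rw [h, Complex.sq_norm, Complex.normSq_add_mul_I]
  nlinarith [sq_nonneg (Real.sinh x * Real.cos y)]

theorem exp_abs_le_two_mul_cosh (x : ℝ) : Real.exp |x| ≤ 2 * Real.cosh x := by
  rw [← Real.cosh_abs, Real.cosh_eq]; nlinarith [Real.exp_pos (-|x|)]

theorem sinh_ne_zero_of_im_mem {t : ℂ} (ht : t.im ∈ Ioo 0 Real.pi) : Complex.sinh t ≠ 0 := by
  intro h
  have h1 := norm_sinh_sq_ge t.re t.im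
  rw [Complex.re_add_im, h] at h1
  have := Real.sin_pos_of_mem_Ioo ht
  have := Real.cosh_pos t.re
  have : 0 < Real.sin t.im ^ 2 * Real.cosh t.re ^ 2 := by positivity
  simp at h1; linarith

/-- On the line `Im t = y` the kernel decays like `e^{-2|Re t|}`, which beats the growth of the
exponential if and only if `|Im w| < 1`. -/
theorem norm_exp_div_sinh_sq_le (w : ℂ) {x y : ℝ} (hy : y ∈ Ioo 0 Real.pi) :
    ‖Complex.exp (-2 * I * w * (x + y * I)) / (4 * Complex.sinh (x + y * I) ^ 2)‖ ≤
      Real.exp (2 * y * w.re) / Real.sin y ^ 2 * Real.exp (-(2 * (1 - |w.im|)) * |x|) := by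
  have hs := Real.sin_pos_of_mem_Ioo hy
  have h1 := norm_sinh_sq_ge x y
  have h2 := exp_abs_le_two_mul_cosh x
  have h3 : Real.exp (2 * |x|) ≤ 4 * Real.cosh x ^ 2 := by
    have : Real.exp (2 * |x|) = Real.exp |x| ^ 2 := by rw [← Real.exp_nat_mul]; norm_num
    rw [this]; nlinarith [Real.exp_pos |x|]
  have h4 : Real.sin y ^ 2 * Real.exp (2 * |x|) ≤ ‖4 * Complex.sinh (x + y * I) ^ 2‖ := by
    rw [norm_mul, norm_pow]; norm_num
    nlinarith [sq_nonneg (Real.sin y)]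
  rw [norm_div, Complex.norm_exp]
  have h5 : (-2 * I * w * (x + y * I)).re = 2 * w.im * x + 2 * y * w.re := by
    simp; ring
  rw [h5, div_le_iff₀ (lt_of_lt_of_le (by positivity) h4)]
  refine le_trans ?_ (mul_le_mul_of_nonneg_left h4 (by positivity))
  have h6 : Real.exp (2 * y * w.re) / Real.sin y ^ 2 * Real.exp (-(2 * (1 - |w.im|)) * |x|) *
      (Real.sin y ^ 2 * Real.exp (2 * |x|)) =
      Real.exp (2 * |w.im| * |x| + 2 * y * w.re) := by
    have : 2 * |w.im| * |x| + 2 * y * w.re =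
      2 * y * w.re + (-(2 * (1 - |w.im|)) * |x| + 2 * |x|) := by ring
    rw [this, Real.exp_add, Real.exp_add]; field_simp
  rw [h6]
  refine Real.exp_le_exp.2 ?_
  have := le_abs_self (w.im * x)
  rw [abs_mul] at this; linarith

theorem qdilogIntegrand_one (w t : ℂ) :
    qdilogIntegrand 1 w t = Complex.exp (-2 * I * w * t) / (4 * Complex.sinh t ^ 2) / t := by
  simp [qdilogIntegrand, pow_two, mul_assoc]

theorem norm_qdilogIntegrand_one_le (w : ℂ) {x y : ℝ} (hy : y ∈ Ioo 0 Real.pi) :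
    ‖qdilogIntegrand 1 w (x + y * I)‖ ≤
      Real.exp (2 * y * w.re) / Real.sin y ^ 2 / y * Real.exp (-(2 * (1 - |w.im|)) * |x|) := by
  rw [qdilogIntegrand_one, norm_div, div_mul_eq_mul_div]
  have h1 : y ≤ ‖(x + y * I : ℂ)‖ := by
    have := Complex.abs_im_le_norm (x + y * I)
    simp at this; exact (le_abs_self y).trans this
  have hs := Real.sin_pos_of_mem_Ioo hy
  exact div_le_div₀ (by positivity) (norm_exp_div_sinh_sq_le w hy) hy.1 h1

theorem differentiableAt_qdilogIntegrand_one (w : ℂ) {t : ℂ} (ht : t.im ∈ Ioo 0 Real.pi) :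
    DifferentiableAt ℂ (qdilogIntegrand 1 w) t := by
  have h0 : t ≠ 0 := by rintro rfl; simp at ht
  have h1 := sinh_ne_zero_of_im_mem ht
  rw [show qdilogIntegrand 1 w = _ from funext fun t => qdilogIntegrand_one w t]
  refine ((DifferentiableAt.div (by fun_prop) (by fun_prop) (by simpa using h1)).div ?_ h0)
  fun_prop

theorem integrable_qdilogIntegrand_one {w : ℂ} (hw : |w.im| < 1) {y : ℝ}
    (hy : y ∈ Ioo 0 Real.pi) : Integrable (fun x : ℝ => qdilogIntegrand 1 w (x + y * I)) := by
  refine ((integrable_exp_neg_mul_abs (c := 2 * (1 - |w.im|)) (by linarith)).const_mul _).mono' ?_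
    (ae_of_all _ fun x => norm_qdilogIntegrand_one_le w hy)
  refine Continuous.aestronglyMeasurable (continuous_iff_continuousAt.2 fun x => ?_)
  have := (differentiableAt_qdilogIntegrand_one w (t := x + y * I) (by simpa using hy)).continuousAt
  exact ContinuousAt.comp (f := fun x : ℝ => (x + y * I : ℂ)) this (by fun_prop)

/-- The logarithm of `Φ₁` in the strip `|Im w| < 1`, as an integral over the line `Im t = π / 2`
halfway between the poles `0` and `πi` of the integrand. -/
noncomputable def logQDilogOne (w : ℂ) : ℂ :=
  ∫ x : ℝ, qdilogIntegrand 1 w (x + (Real.pi / 2 : ℝ) * I)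

/-- The limit `ε → 0` in the definition of the exponent is that of a constant function. -/
theorem integral_qdilogIntegrand_one {w : ℂ} (hw : |w.im| < 1) {y : ℝ}
    (hy : y ∈ Ioo 0 Real.pi) :
    ∫ x : ℝ, qdilogIntegrand 1 w (x + y * I) = logQDilogOne w := by
  have hπ : Real.pi / 2 ∈ Ioo 0 Real.pi := ⟨by positivity, by linarith [Real.pi_pos]⟩
  have hsub : uIcc y (Real.pi / 2) ⊆ Ioo 0 Real.pi := (ordConnected_Ioo).uIcc_subset hy hπ
  have hcont : ContinuousOn (fun y : ℝ => Real.exp (2 * y * w.re) / Real.sin y ^ 2 / y)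
      (uIcc y (Real.pi / 2)) := by
    refine ContinuousOn.div (ContinuousOn.div (by fun_prop) (by fun_prop) fun v hv => ?_)
      (by fun_prop) fun v hv => (hsub hv).1.ne'
    exact pow_ne_zero _ (Real.sin_pos_of_mem_Ioo (hsub hv)).ne'
  obtain ⟨C, hC⟩ := isCompact_uIcc.exists_bound_of_continuousOn hcont
  refine integral_horizontal_line_eq (c := 2 * (1 - |w.im|)) (C := C) (by linarith)
    (fun t ht => (differentiableAt_qdilogIntegrand_one w (hsub ht)).differentiableWithinAt)
    fun x v hv => (norm_qdilogIntegrand_one_le w (hsub hv)).trans ?_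
  gcongr
  exact (le_abs_self _).trans (hC v hv)

theorem tendsto_logQDilogOne_sub {w : ℂ} (hw : |w.im| < 1) :
    Tendsto (fun r : ℝ => logQDilogOne (w - r)) atTop (𝓝 0) := by
  have hπ : Real.pi / 2 ∈ Ioo 0 Real.pi := ⟨by positivity, by linarith [Real.pi_pos]⟩
  set J : ℝ := ∫ x : ℝ, Real.exp (-(2 * (1 - |w.im|)) * |x|)
  have hb : ∀ r : ℝ, ‖logQDilogOne (w - r)‖ ≤
      Real.exp (2 * (Real.pi / 2) * (w.re - r)) / Real.sin (Real.pi / 2) ^ 2 / (Real.pi / 2) *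
        J := by
    intro r
    rw [← integral_const_mul]
    refine norm_integral_le_of_norm_le
      ((integrable_exp_neg_mul_abs (by linarith)).const_mul _) (ae_of_all _ fun x => ?_)
    have := norm_qdilogIntegrand_one_le (w - r) (x := x) hπ
    simpa using this
  refine squeeze_zero_norm hb ?_
  have : Tendsto (fun r : ℝ => Real.exp (2 * (Real.pi / 2) * (w.re - r))) atTop (𝓝 0) := by
    refine Real.tendsto_exp_atBot.comp (Tendsto.const_mul_atBot (by positivity) ?_)
    exact tendsto_atBot_add_const_left _ _ tendsto_neg_atTop_atBot
  simpa only [zero_div, zero_mul] using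
    ((this.div_const (Real.sin (Real.pi / 2) ^ 2)).div_const (Real.pi / 2)).mul_const J

theorem qdilogExponent_one {w : ℂ} (hw : |w.im| < 1) : qdilogExponent 1 w = logQDilogOne w := by
  refine Tendsto.limUnder_eq (tendsto_const_nhds.congr' ?_)
  filter_upwards [Ioo_mem_nhdsGT Real.pi_pos] with ε hε
  exact (integral_qdilogIntegrand_one hw hε).symm

/-! ### The derivative of `log Φ₁` in the strip -/

theorem sigmoid_two_mul (x : ℝ) :
    Real.sigmoid (2 * x) = Real.exp x / (2 * Real.cosh x) := by
  rw [Real.sigmoid_def, Real.cosh_eq, show -(2 * x) = -x + -x by ring, Real.exp_add,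
    Real.exp_neg]
  have := Real.exp_pos x
  field_simp

theorem one_sub_sigmoid_two_mul (x : ℝ) :
    1 - Real.sigmoid (2 * x) = Real.exp (-x) / (2 * Real.cosh x) := by
  rw [← Real.sigmoid_neg, ← mul_neg, sigmoid_two_mul, Real.cosh_neg]

/-- The Fourier transform of `1 / cosh²`; the substitution `v = 1 / (1 + e^{-2x})` turns it into
a Beta integral. -/
theorem integral_exp_div_cosh_sq_eq_betaIntegral (w : ℂ) :
    ∫ x : ℝ, Complex.exp (-2 * I * w * x) / Complex.cosh x ^ 2 =
      2 * betaIntegral (1 - I * w) (1 + I * w) := by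
  have himage : (fun x : ℝ => Real.sigmoid (2 * x)) '' univ = Ioo 0 1 := by
    rw [image_univ, ← Real.range_sigmoid]
    exact (mul_left_surjective₀ (two_ne_zero (α := ℝ))).range_comp Real.sigmoid
  have hderiv : ∀ x ∈ (univ : Set ℝ), HasDerivWithinAt (fun x : ℝ => Real.sigmoid (2 * x))
      (Real.sigmoid (2 * x) * (1 - Real.sigmoid (2 * x)) * 2) univ x := by
    intro x _
    have := (Real.hasDerivAt_sigmoid (2 * x)).comp x ((hasDerivAt_id x).const_mul 2)
    exact HasDerivAt.hasDerivWithinAt (by simpa [Function.comp_def] using this)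
  have hinj : InjOn (fun x : ℝ => Real.sigmoid (2 * x)) univ := fun x _ y _ h => by
    have := Real.sigmoid_injective h
    linarith
  have key := integral_image_eq_integral_abs_deriv_smul MeasurableSet.univ hderiv hinj
    (fun v : ℝ => (v : ℂ) ^ ((1 - I * w) - 1) * (1 - (v : ℂ)) ^ ((1 + I * w) - 1))
  rw [himage] at key
  rw [betaIntegral, intervalIntegral.integral_of_le zero_le_one, integral_Ioc_eq_integral_Ioo, key,
    setIntegral_univ, ← integral_const_mul]
  congr 1 with x
  have hc := Real.cosh_pos x
  have hlog : ∀ y : ℝ, Real.log (Real.exp y / (2 * Real.cosh x)) =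
      y - Real.log (2 * Real.cosh x) := fun y => by
    rw [Real.log_div (Real.exp_pos _).ne' (by positivity), Real.log_exp]
  have h1 : (1 : ℂ) - (Real.sigmoid (2 * x) : ℝ) = ((1 - Real.sigmoid (2 * x) : ℝ) : ℂ) := by
    push_cast; rfl
  have h2 : Real.sigmoid (2 * x) * (1 - Real.sigmoid (2 * x)) * 2 = 1 / (2 * Real.cosh x ^ 2) := by
    rw [one_sub_sigmoid_two_mul, sigmoid_two_mul, Real.exp_neg]
    have := Real.exp_pos x
    field_simp
  have hpos : ∀ y : ℝ, 0 < Real.exp y / (2 * Real.cosh x) := fun y => by positivity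
  rw [h1, h2, one_sub_sigmoid_two_mul, sigmoid_two_mul,
    cpow_def_of_ne_zero (by exact_mod_cast (hpos x).ne'),
    cpow_def_of_ne_zero (by exact_mod_cast (hpos (-x)).ne'),
    ← ofReal_log (hpos x).le, ← ofReal_log (hpos (-x)).le, hlog, hlog, ← Complex.exp_add,
    abs_of_pos (by positivity), real_smul]
  have h3 : ((x - Real.log (2 * Real.cosh x) : ℝ) : ℂ) * (1 - I * w - 1) +
      ((-x - Real.log (2 * Real.cosh x) : ℝ) : ℂ) * (1 + I * w - 1) = -2 * I * w * x := by
    push_cast; ring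
  rw [h3]
  push_cast
  have : Complex.cosh x ≠ 0 := by rw [← ofReal_cosh]; exact_mod_cast hc.ne'
  field_simp

theorem integral_exp_div_cosh_sq {w : ℂ} (hw : |w.im| < 1) (h0 : w ≠ 0) :
    ∫ x : ℝ, Complex.exp (-2 * I * w * x) / Complex.cosh x ^ 2 =
      2 * Real.pi * w / Complex.sinh (Real.pi * w) := by
  obtain ⟨h1, h2⟩ := abs_lt.1 hw
  have hG := Complex.Gamma_mul_Gamma_eq_betaIntegral (s := 1 - I * w) (t := 1 + I * w)
    (by simp; linarith) (by simp; linarith)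
  have hI : I * w ≠ 0 := mul_ne_zero I_ne_zero h0
  rw [show 1 - I * w + (1 + I * w) = 1 + 1 by ring, Complex.Gamma_add_one 1 one_ne_zero,
    Complex.Gamma_one, one_mul, one_mul, add_comm 1 (I * w), Complex.Gamma_add_one _ hI] at hG
  rw [integral_exp_div_cosh_sq_eq_betaIntegral, add_comm 1 (I * w), ← hG]
  have hR := Complex.Gamma_mul_Gamma_one_sub (I * w)
  have hsin : Complex.sin (Real.pi * (I * w)) = Complex.sinh (Real.pi * w) * I := by
    rw [← Complex.sin_mul_I]; ring_nf
  rw [hsin] at hR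
  calc 2 * (Complex.Gamma (1 - I * w) * (I * w * Complex.Gamma (I * w)))
      = 2 * (I * w) * (Complex.Gamma (I * w) * Complex.Gamma (1 - I * w)) := by ring
    _ = _ := by
      rw [hR, mul_comm _ I, ← div_div]
      field_simp

/-- Differentiation in `w` cancels the factor `1 / t`; on the line `Im t = π / 2` one has
`sinh² t = - cosh² (Re t)`. -/
theorem hasDerivAt_logQDilogOne_integral {w : ℂ} (hw : |w.im| < 1) :
    HasDerivAt logQDilogOne (I / 2 * Complex.exp (Real.pi * w) *
      ∫ x : ℝ, Complex.exp (-2 * I * w * x) / Complex.cosh x ^ 2) w := by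
  have hπ : Real.pi / 2 ∈ Ioo 0 Real.pi := ⟨by positivity, by linarith [Real.pi_pos]⟩
  obtain ⟨c, hc1, hc2⟩ := exists_between hw
  set s : Set ℂ := {v | |v.im| < c ∧ v.re < w.re + 1}
  have hs : s ∈ 𝓝 w := by
    exact IsOpen.mem_nhds (IsOpen.inter (isOpen_lt continuous_im.abs continuous_const)
      (isOpen_lt continuous_re continuous_const)) ⟨hc1, by simp⟩
  have him : ∀ x : ℝ, (x + (Real.pi / 2 : ℝ) * I : ℂ).im ∈ Ioo 0 Real.pi := fun x => by
    simpa using hπ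
  have hne : ∀ x : ℝ, (x + (Real.pi / 2 : ℝ) * I : ℂ) ≠ 0 := fun x h => by
    have := him x; rw [h] at this; simp at this
  set F' : ℂ → ℝ → ℂ := fun v x => -2 * I *
    (Complex.exp (-2 * I * v * (x + (Real.pi / 2 : ℝ) * I)) /
      (4 * Complex.sinh (x + (Real.pi / 2 : ℝ) * I) ^ 2)) with hF'
  have key := hasDerivAt_integral_of_dominated_loc_of_deriv_le (μ := volume)
    (F := fun v (x : ℝ) => qdilogIntegrand 1 v (x + (Real.pi / 2 : ℝ) * I)) (F' := F')
    (bound := fun x => 2 * (Real.exp (2 * (Real.pi / 2) * (w.re + 1)) /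
      Real.sin (Real.pi / 2) ^ 2 * Real.exp (-(2 * (1 - c)) * |x|))) hs ?_
    (integrable_qdilogIntegrand_one hw hπ) ?_ ?_ ?_ ?_
  · have h2 : ∫ x : ℝ, F' w x = I / 2 * Complex.exp (Real.pi * w) *
        ∫ x : ℝ, Complex.exp (-2 * I * w * x) / Complex.cosh x ^ 2 := by
      rw [← integral_const_mul]
      congr 1 with x
      have e1 : Complex.sinh (x + (Real.pi / 2 : ℝ) * I) = Complex.cosh x * I := by
        rw [Complex.sinh_add, Complex.sinh_mul_I, Complex.cosh_mul_I]; simp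
      have e2 : -2 * I * w * (x + (Real.pi / 2 : ℝ) * I) = Real.pi * w + -2 * I * w * x := by
        push_cast; linear_combination (-Real.pi * w : ℂ) * I_sq
      rw [hF']
      simp only [e1, e2, Complex.exp_add, mul_pow, I_sq]
      ring
    rw [h2] at key
    exact key.2
  · filter_upwards [hs] with v hv
    exact (integrable_qdilogIntegrand_one (hv.1.trans hc2) hπ).aestronglyMeasurable
  · refine Continuous.aestronglyMeasurable (Continuous.mul continuous_const
      (Continuous.div (by fun_prop) (by fun_prop) fun x => ?_))
    simpa using sinh_ne_zero_of_im_mem (him x)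
  · refine ae_of_all _ fun x v hv => ?_
    rw [hF', norm_mul]
    have : ‖-2 * I‖ = 2 := by simp
    rw [this]
    refine mul_le_mul_of_nonneg_left ((norm_exp_div_sinh_sq_le v hπ).trans ?_) zero_le_two
    have := hv.1.le
    have := hv.2.le
    gcongr
  · exact (((integrable_exp_neg_mul_abs (by linarith)).const_mul _).const_mul _)
  · refine ae_of_all _ fun x v _ => ?_
    simp_rw [qdilogIntegrand_one]
    have h1 : HasDerivAt (fun v : ℂ => -2 * I * v * (x + (Real.pi / 2 : ℝ) * I))
        (-2 * I * (x + (Real.pi / 2 : ℝ) * I)) v := by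
      simpa using ((hasDerivAt_id v).const_mul (-2 * I)).mul_const (x + (Real.pi / 2 : ℝ) * I : ℂ)
    refine ((h1.cexp.div_const (4 * Complex.sinh (x + (Real.pi / 2 : ℝ) * I) ^ 2)).div_const
      (x + (Real.pi / 2 : ℝ) * I : ℂ)).congr_deriv ?_
    have h2 := hne x
    have h3 := sinh_ne_zero_of_im_mem (him x)
    simp only [F']
    generalize (x + (Real.pi / 2 : ℝ) * I : ℂ) = t at h2 h3 ⊢
    field_simp

theorem differentiableOn_logQDilogOne : DifferentiableOn ℂ logQDilogOne {w | |w.im| < 1} :=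
  fun _ hw => (hasDerivAt_logQDilogOne_integral hw).differentiableAt.differentiableWithinAt

theorem hasDerivAt_logQDilogOne {w : ℂ} (hw : |w.im| < 1) (h0 : w ≠ 0) :
    HasDerivAt logQDilogOne (-2 * Real.pi * I * w * Complex.exp (2 * Real.pi * w) /
      (1 - Complex.exp (2 * Real.pi * w))) w := by
  have h := hasDerivAt_logQDilogOne_integral hw
  rw [integral_exp_div_cosh_sq hw h0] at h
  convert h using 1
  have e : Complex.exp (2 * Real.pi * w) =
      Complex.exp (Real.pi * w) * Complex.exp (Real.pi * w) := by
    rw [← Complex.exp_add]; ring_nf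
  have hs : Complex.sinh (Real.pi * w) =
      -(1 - Complex.exp (2 * Real.pi * w)) / (2 * Complex.exp (Real.pi * w)) := by
    rw [Complex.sinh, Complex.exp_neg, e]
    have := Complex.exp_ne_zero (Real.pi * w)
    field_simp; ring
  rw [hs]
  by_cases h1 : 1 - Complex.exp (2 * Real.pi * w) = 0
  · simp [h1]
  · have := Complex.exp_ne_zero (Real.pi * w)
    field_simp
    rw [e]; ring

/-! ### The dilogarithm and the closed form of `log Φ₁` -/

/-- The plane without the rays `[0, ∞) + in`, for all integers `n`: the points `w` such that
`e^{2πw}` is not in the cut `[1, ∞)` of the dilogarithm. -/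
def dilogPlane : Set ℂ :=
  {w : ℂ | ∀ n : ℤ, 0 ≤ w.re → w.im ≠ (n : ℝ)}

theorem one_sub_exp_mem_slitPlane {w : ℂ} (hw : w ∈ dilogPlane) :
    1 - Complex.exp (2 * Real.pi * w) ∈ slitPlane := by
  by_contra h
  rw [mem_slitPlane_iff, not_or, not_lt, not_not] at h
  obtain ⟨h1, h2⟩ := h
  simp only [sub_re, one_re, sub_im, one_im] at h1 h2
  set x := (Complex.exp (2 * Real.pi * w)).re with hx
  have hx1 : 1 ≤ x := by linarith
  have hexp : Complex.exp (2 * Real.pi * w) = Complex.exp (Real.log x : ℝ) := by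
    rw [← ofReal_exp, Real.exp_log (by linarith)]
    apply Complex.ext
    · simp [hx]
    · simp; linarith
  obtain ⟨n, hn⟩ := Complex.exp_eq_exp_iff_exists_int.1 hexp
  have hre := congrArg Complex.re hn
  have him := congrArg Complex.im hn
  simp at hre him
  have hlog := Real.log_nonneg hx1
  refine hw n ?_ ?_
  · rw [← hre] at hlog
    exact nonneg_of_mul_nonneg_right hlog (by positivity)
  · have : 2 * Real.pi * (w.im - n) = 0 := by linarith
    have := (mul_eq_zero.1 this).resolve_left (by positivity)
    linarith

theorem sub_ofReal_mem_dilogPlane {w : ℂ} (hw : w ∈ dilogPlane) {r : ℝ} (hr : 0 ≤ r) :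
    w - r ∈ dilogPlane := by
  intro n h
  simp only [sub_re, ofReal_re, sub_im, ofReal_im, sub_zero] at h ⊢
  exact hw n (by linarith)

theorem exp_two_pi_mul_ne_one {w : ℂ} (hw : w ∈ dilogPlane) :
    1 - Complex.exp (2 * Real.pi * w) ≠ 0 :=
  slitPlane_ne_zero (one_sub_exp_mem_slitPlane hw)

theorem one_sub_ofReal_mul_mem_slitPlane {u : ℂ} (hu : 1 - u ∈ slitPlane) {t : ℝ}
    (ht : t ∈ Icc (0 : ℝ) 1) : 1 - t * u ∈ slitPlane := by
  have := starConvex_one_slitPlane hu (sub_nonneg.2 ht.2) ht.1 (by ring)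
  convert this using 1
  simp only [real_smul]; push_cast; ring

theorem hasDerivAt_log_one_sub_ofReal_mul {u : ℂ} {t : ℝ} (h : 1 - t * u ∈ slitPlane) :
    HasDerivAt (fun t : ℝ => Complex.log (1 - t * u)) (-u / (1 - t * u)) t := by
  have : HasDerivAt (fun t : ℝ => 1 - (t : ℂ) * u) (-u) t := by
    simpa using ((hasDerivAt_id t).ofReal_comp.mul_const u).const_sub 1
  exact this.clog_real h

theorem intervalIntegrable_log_one_sub_mul_div {u : ℂ} (hu : 1 - u ∈ slitPlane) :
    IntervalIntegrable (fun t : ℝ => Complex.log (1 - t * u) / t) volume 0 1 := by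
  set g : ℝ → ℂ := fun t => Complex.log (1 - t * u) with hg
  set s : Set ℝ := {t | 1 - t * u ∈ slitPlane} with hs
  have hso : IsOpen s := isOpen_slitPlane.preimage (by fun_prop)
  have h0 : (0 : ℝ) ∈ s := by simp [hs]
  have hd : ∀ t ∈ s, HasDerivAt g (-u / (1 - t * u)) t :=
    fun t ht => hasDerivAt_log_one_sub_ofReal_mul ht
  have hcont : ContinuousOn (dslope g 0) s :=
    (continuousOn_dslope (hso.mem_nhds h0)).2
      ⟨fun t ht => (hd t ht).continuousAt.continuousWithinAt, (hd 0 h0).differentiableAt⟩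
  have hsub : uIcc (0 : ℝ) 1 ⊆ s := fun t ht => by
    rw [uIcc_of_le zero_le_one] at ht
    exact one_sub_ofReal_mul_mem_slitPlane hu ht
  -- The integrand is the slope of `t ↦ log (1 - t u)` at `0`, which extends continuously to `0`.
  refine (hcont.mono hsub).intervalIntegrable.congr fun t ht => ?_
  rw [uIoc_of_le zero_le_one] at ht
  rw [dslope_of_ne _ ht.1.ne', slope_def_module]
  simp [hg, div_eq_inv_mul]

theorem integral_neg_inv_one_sub_mul {u : ℂ} (hu : 1 - u ∈ slitPlane) (h0 : u ≠ 0) :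
    ∫ t in (0 : ℝ)..1, -1 / (1 - t * u) = Complex.log (1 - u) / u := by
  have hmem : ∀ t ∈ uIcc (0 : ℝ) 1, 1 - t * u ∈ slitPlane := fun t ht => by
    rw [uIcc_of_le zero_le_one] at ht
    exact one_sub_ofReal_mul_mem_slitPlane hu ht
  have key := intervalIntegral.integral_eq_sub_of_hasDerivAt
    (fun t ht => (hasDerivAt_log_one_sub_ofReal_mul (hmem t ht)).div_const u)
    (ContinuousOn.intervalIntegrable ?_)
  · simp only [ofReal_one, one_mul, ofReal_zero, zero_mul, sub_zero, Complex.log_one,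
      zero_div] at key
    rw [← key]
    congr 1 with t
    field_simp
  · exact (continuousOn_const.div (by fun_prop)
      fun t ht => slitPlane_ne_zero (hmem t ht)).div_const _

theorem hasDerivAt_dilog_integral {u : ℂ} (hu : 1 - u ∈ slitPlane) :
    HasDerivAt dilog (-∫ t in (0 : ℝ)..1, -1 / (1 - t * u)) u := by
  have hU : IsOpen {v : ℂ | 1 - v ∈ slitPlane} := isOpen_slitPlane.preimage (by fun_prop)
  obtain ⟨r, hr, hball⟩ := Metric.isOpen_iff.1 hU u hu
  have hball' : Metric.closedBall u (r / 2) ⊆ {v : ℂ | 1 - v ∈ slitPlane} :=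
    (Metric.closedBall_subset_ball (by linarith)).trans hball
  have hcont : ContinuousOn (fun p : ℝ × ℂ => -1 / (1 - p.1 * p.2))
      (Icc (0 : ℝ) 1 ×ˢ Metric.closedBall u (r / 2)) :=
    continuousOn_const.div (by fun_prop) fun p hp =>
      slitPlane_ne_zero (one_sub_ofReal_mul_mem_slitPlane (hball' hp.2) hp.1)
  obtain ⟨M, hM⟩ :=
    (isCompact_Icc.prod (isCompact_closedBall u (r / 2))).exists_bound_of_continuousOn hcont
  have hcl : Metric.closedBall u (r / 2) ∈ 𝓝 u := Metric.closedBall_mem_nhds u (by linarith)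
  refine (intervalIntegral.hasDerivAt_integral_of_dominated_loc_of_deriv_le (μ := volume)
    (F := fun (v : ℂ) (t : ℝ) => Complex.log (1 - t * v) / t)
    (F' := fun (v : ℂ) (t : ℝ) => -1 / (1 - t * v)) (bound := fun _ => M)
    (s := Metric.closedBall u (r / 2)) hcl ?_
    (intervalIntegrable_log_one_sub_mul_div hu) ?_ ?_ intervalIntegrable_const ?_).2.neg
  · filter_upwards [hcl] with v hv
    have := (intervalIntegrable_log_one_sub_mul_div (hball' hv)).aestronglyMeasurable
    rwa [uIoc_of_le zero_le_one]
  · rw [uIoc_of_le zero_le_one]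
    refine ContinuousOn.aestronglyMeasurable ?_ measurableSet_Ioc
    exact continuousOn_const.div (by fun_prop) fun t ht =>
      slitPlane_ne_zero (one_sub_ofReal_mul_mem_slitPlane hu (Ioc_subset_Icc_self ht))
  · refine ae_of_all _ fun t ht v hv => hM (t, v) ⟨?_, hv⟩
    rw [uIoc_of_le zero_le_one] at ht
    exact Ioc_subset_Icc_self ht
  · refine ae_of_all _ fun t ht v hv => ?_
    rw [uIoc_of_le zero_le_one] at ht
    have h1 : HasDerivAt (fun v : ℂ => 1 - (t : ℂ) * v) (-t) v := by
      simpa using ((hasDerivAt_id v).const_mul (t : ℂ)).const_sub 1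
    have h2 := one_sub_ofReal_mul_mem_slitPlane (hball' hv) (Ioc_subset_Icc_self ht)
    refine ((h1.clog h2).div_const (t : ℂ)).congr_deriv ?_
    have h3 : (t : ℂ) ≠ 0 := by exact_mod_cast ht.1.ne'
    field_simp

theorem hasDerivAt_dilog {u : ℂ} (hu : 1 - u ∈ slitPlane) (h0 : u ≠ 0) :
    HasDerivAt dilog (-(Complex.log (1 - u) / u)) u := by
  rw [← integral_neg_inv_one_sub_mul hu h0]
  exact hasDerivAt_dilog_integral hu

theorem dilog_zero : dilog 0 = 0 := by simp [dilog]

theorem hasDerivAt_exp_two_pi_mul (w : ℂ) :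
    HasDerivAt (fun w : ℂ => Complex.exp (2 * Real.pi * w))
      (Complex.exp (2 * Real.pi * w) * (2 * Real.pi)) w := by
  simpa using ((hasDerivAt_id w).const_mul (2 * Real.pi : ℂ)).cexp

theorem hasDerivAt_log_one_sub_exp {w : ℂ} (hw : w ∈ dilogPlane) :
    HasDerivAt (fun w : ℂ => Complex.log (1 - Complex.exp (2 * Real.pi * w)))
      (-(Complex.exp (2 * Real.pi * w) * (2 * Real.pi)) / (1 - Complex.exp (2 * Real.pi * w))) w :=
  ((hasDerivAt_exp_two_pi_mul w).const_sub 1).clog (one_sub_exp_mem_slitPlane hw)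

theorem hasDerivAt_dilog_exp {w : ℂ} (hw : w ∈ dilogPlane) :
    HasDerivAt (fun w : ℂ => dilog (Complex.exp (2 * Real.pi * w)))
      (-2 * Real.pi * Complex.log (1 - Complex.exp (2 * Real.pi * w))) w := by
  have h := (hasDerivAt_dilog (one_sub_exp_mem_slitPlane hw) (Complex.exp_ne_zero _)).comp w
    (hasDerivAt_exp_two_pi_mul w)
  refine h.congr_deriv ?_
  have := Complex.exp_ne_zero (2 * Real.pi * w)
  field_simp

theorem tendsto_exp_two_pi_mul_sub (w : ℂ) :
    Tendsto (fun r : ℝ => Complex.exp (2 * Real.pi * (w - r))) atTop (𝓝 0) := by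
  refine Complex.tendsto_exp_nhds_zero_iff.2 ?_
  have : ∀ r : ℝ, (2 * Real.pi * (w - r) : ℂ).re = 2 * Real.pi * (w.re - r) := fun r => by simp
  simp_rw [this]
  exact Tendsto.const_mul_atBot (by positivity)
    (tendsto_atBot_add_const_left _ _ tendsto_neg_atTop_atBot)

theorem tendsto_log_one_sub_exp_sub (w : ℂ) :
    Tendsto (fun r : ℝ => Complex.log (1 - Complex.exp (2 * Real.pi * (w - r)))) atTop (𝓝 0) := by
  have h : Tendsto (fun u : ℂ => Complex.log (1 - u)) (𝓝 0) (𝓝 (Complex.log (1 - 0))) :=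
    (ContinuousAt.clog (by fun_prop) (by simp))
  simpa [Function.comp_def] using h.comp (tendsto_exp_two_pi_mul_sub w)

theorem tendsto_dilog_exp_sub (w : ℂ) :
    Tendsto (fun r : ℝ => dilog (Complex.exp (2 * Real.pi * (w - r)))) atTop (𝓝 0) := by
  have h : Tendsto dilog (𝓝 0) (𝓝 (dilog 0)) :=
    (hasDerivAt_dilog_integral (u := 0) (by simp)).continuousAt
  rw [dilog_zero] at h
  exact h.comp (tendsto_exp_two_pi_mul_sub w)

theorem tendsto_mul_log_one_sub_exp_sub (w : ℂ) :
    Tendsto (fun r : ℝ => (w - r) * Complex.log (1 - Complex.exp (2 * Real.pi * (w - r)))) atTop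
      (𝓝 0) := by
  have h0 : Tendsto (fun r : ℝ => 3 / 2 * Real.exp (2 * Real.pi * w.re) *
      (‖w‖ * (r ^ 0 * Real.exp (-r)) + r ^ 1 * Real.exp (-r))) atTop (𝓝 0) := by
    simpa using (((Real.tendsto_pow_mul_exp_neg_atTop_nhds_zero 0).const_mul ‖w‖).add
      (Real.tendsto_pow_mul_exp_neg_atTop_nhds_zero 1)).const_mul
        (3 / 2 * Real.exp (2 * Real.pi * w.re))
  refine squeeze_zero_norm' ?_ h0
  have hsmall := (tendsto_exp_two_pi_mul_sub w).norm
  rw [norm_zero] at hsmall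
  filter_upwards [eventually_ge_atTop 0, hsmall.eventually_le_const (u := 1 / 2) (by norm_num)]
    with r hr hu
  have h1 : ‖Complex.log (1 - Complex.exp (2 * Real.pi * (w - r)))‖ ≤
      3 / 2 * ‖Complex.exp (2 * Real.pi * (w - r))‖ := by
    have := Complex.norm_log_one_add_half_le_self (z := -Complex.exp (2 * Real.pi * (w - r)))
      (by simpa using hu)
    simpa [← sub_eq_add_neg] using this
  have h2 : ‖Complex.exp (2 * Real.pi * (w - r))‖ ≤
      Real.exp (2 * Real.pi * w.re) * Real.exp (-r) := by
    rw [Complex.norm_exp, ← Real.exp_add]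
    refine Real.exp_le_exp.2 ?_
    simp
    nlinarith [Real.pi_gt_three]
  have h3 : ‖w - r‖ ≤ ‖w‖ + r := by
    simpa [abs_of_nonneg hr] using norm_sub_le w (r : ℂ)
  rw [norm_mul]
  calc _ ≤ (‖w‖ + r) * (3 / 2 * (Real.exp (2 * Real.pi * w.re) * Real.exp (-r))) := by
        gcongr; exact h1.trans (by gcongr)
    _ = _ := by ring

/-- A function with zero derivative along the ray from `w` to the left and with limit zero at the
far end of the ray vanishes at `w`. -/
theorem eq_zero_of_hasDerivAt_zero_of_tendsto {f : ℂ → ℂ} {w : ℂ}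
    (h : ∀ r : ℝ, 0 ≤ r → HasDerivAt f 0 (w - r))
    (hl : Tendsto (fun r : ℝ => f (w - r)) atTop (𝓝 0)) : f w = 0 := by
  have hg : ∀ r : ℝ, 0 ≤ r → HasDerivAt (fun r : ℝ => f (w - r)) 0 r := fun r hr => by
    have h1 : HasDerivAt (fun r : ℝ => w - (r : ℂ)) (-1) r := by
      simpa using (hasDerivAt_id r).ofReal_comp.const_sub w
    have h2 := HasDerivAt.comp_of_eq r (h r hr) h1 rfl
    rw [zero_mul] at h2
    exact h2
  have hconst : ∀ r : ℝ, 0 ≤ r → f (w - r) = f w := fun r hr => by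
    have := constant_of_has_deriv_right_zero (a := 0) (b := r) (f := fun r : ℝ => f (w - r))
      (fun x hx => (hg x hx.1).continuousAt.continuousWithinAt)
      (fun x hx => (hg x hx.1).hasDerivWithinAt) r ⟨hr, le_rfl⟩
    simpa using this
  refine tendsto_nhds_unique (tendsto_const_nhds.congr' ?_) hl
  filter_upwards [eventually_ge_atTop 0] with r hr
  exact (hconst r hr).symm

/-- The closed form `(i / 2π) Li₂(e^{2πw}) + i w log (1 - e^{2πw})` of `log Φ₁(w)`. -/
noncomputable def dilogLogQDilogOne (w : ℂ) : ℂ :=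
  I / (2 * Real.pi) * dilog (Complex.exp (2 * Real.pi * w)) +
    I * (w * Complex.log (1 - Complex.exp (2 * Real.pi * w)))

/-- The logarithms from the two summands cancel. -/
theorem hasDerivAt_dilogLogQDilogOne {w : ℂ} (hw : w ∈ dilogPlane) :
    HasDerivAt dilogLogQDilogOne (-2 * Real.pi * I * w * Complex.exp (2 * Real.pi * w) /
      (1 - Complex.exp (2 * Real.pi * w))) w := by
  have h := ((hasDerivAt_dilog_exp hw).const_mul (I / (2 * Real.pi))).add
    (((hasDerivAt_id w).mul (hasDerivAt_log_one_sub_exp hw)).const_mul I)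
  refine h.congr_deriv ?_
  have := exp_two_pi_mul_ne_one hw
  have hpi : (Real.pi : ℂ) ≠ 0 := by exact_mod_cast Real.pi_ne_zero
  simp only [id]
  field_simp
  ring

theorem tendsto_dilogLogQDilogOne_sub (w : ℂ) :
    Tendsto (fun r : ℝ => dilogLogQDilogOne (w - r)) atTop (𝓝 0) := by
  simpa [dilogLogQDilogOne] using ((tendsto_dilog_exp_sub w).const_mul (I / (2 * Real.pi))).add
    ((tendsto_mul_log_one_sub_exp_sub w).const_mul I)

/-- Both sides have derivative `-2πi w e^{2πw} / (1 - e^{2πw})` and tend to zero at the left. -/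
theorem logQDilogOne_eq_dilogLogQDilogOne {w : ℂ} (hw : |w.im| < 1) (hw' : w ∈ dilogPlane) :
    logQDilogOne w = dilogLogQDilogOne w := by
  rw [← sub_eq_zero]
  refine eq_zero_of_hasDerivAt_zero_of_tendsto
    (f := fun w => logQDilogOne w - dilogLogQDilogOne w) (fun r hr => ?_) ?_
  · have h1 := sub_ofReal_mem_dilogPlane hw' hr
    have h0 : w - r ≠ 0 := fun h => h1 0 (by simp [h]) (by simp [h])
    refine ((hasDerivAt_logQDilogOne (by simpa using hw) h0).sub
      (hasDerivAt_dilogLogQDilogOne h1)).congr_deriv (sub_self _)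
  · simpa using (tendsto_logQDilogOne_sub hw).sub (tendsto_dilogLogQDilogOne_sub w)

/-! ### Meromorphic continuation -/

/-- The function `Φ₁` on the whole plane: translating the formula for `log Φ₁` by `in` only
changes the coefficient of `log (1 - e^{2πw})`, so the values on the strip `|Im w| < 1`, translated
by `in` and multiplied by `(1 - e^{2πw})⁻ⁿ`, continue `Φ₁` to `|Im w - n| < 1`. Here `n` is taken
to be the integer part of `Im w`. -/
noncomputable def qdilogOne (w : ℂ) : ℂ :=
  Complex.exp (logQDilogOne (w - ⌊w.im⌋ * I)) *
    (1 - Complex.exp (2 * Real.pi * w)) ^ (-⌊w.im⌋)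

theorem abs_im_sub_floor_lt (w : ℂ) : |w.im - (⌊w.im⌋ : ℤ)| < 1 := by
  rw [abs_lt]
  constructor <;> linarith [Int.floor_le w.im, Int.lt_floor_add_one w.im]

theorem exp_two_pi_mul_sub_int_mul_I (w : ℂ) (n : ℤ) :
    Complex.exp (2 * Real.pi * (w - n * I)) = Complex.exp (2 * Real.pi * w) := by
  rw [show 2 * Real.pi * (w - n * I) = 2 * Real.pi * w - n * (2 * Real.pi * I) by ring]
  exact Complex.exp_periodic.sub_int_mul_eq n

theorem sub_int_mul_I_mem_dilogPlane {w : ℂ} (hw : w ∈ dilogPlane) (n : ℤ) :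
    w - n * I ∈ dilogPlane := by
  intro m h him
  simp only [sub_re, mul_re, intCast_re, I_re, mul_zero, intCast_im, I_im, mul_one, sub_self,
    sub_zero, sub_im, mul_im, add_zero] at h him
  exact hw (m + n) h (by push_cast; linarith)

/-- Off the cuts the value of the translated formula does not depend on `n`. -/
theorem exp_logQDilogOne_mul_zpow {w : ℂ} (hw : w ∈ dilogPlane) {n : ℤ}
    (hn : |w.im - n| < 1) :
    Complex.exp (logQDilogOne (w - n * I)) * (1 - Complex.exp (2 * Real.pi * w)) ^ (-n) =
      Complex.exp (dilogLogQDilogOne w) := by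
  have h0 := exp_two_pi_mul_ne_one hw
  rw [logQDilogOne_eq_dilogLogQDilogOne (by simpa using hn) (sub_int_mul_I_mem_dilogPlane hw n)]
  have h1 : dilogLogQDilogOne (w - n * I) = dilogLogQDilogOne w +
      n * Complex.log (1 - Complex.exp (2 * Real.pi * w)) := by
    rw [dilogLogQDilogOne, dilogLogQDilogOne, exp_two_pi_mul_sub_int_mul_I]
    linear_combination (-n * Complex.log (1 - Complex.exp (2 * Real.pi * w)) : ℂ) * I_sq
  rw [h1, Complex.exp_add, Complex.exp_int_mul, Complex.exp_log h0, mul_assoc, zpow_neg,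
    mul_inv_cancel₀ (zpow_ne_zero _ h0), mul_one]

theorem qdilogOne_eq_exp {w : ℂ} (hw : w ∈ dilogPlane) :
    qdilogOne w = Complex.exp (dilogLogQDilogOne w) :=
  exp_logQDilogOne_mul_zpow hw (abs_im_sub_floor_lt w)

/-- The formulas for neighbouring `n` agree where both apply. -/
theorem qdilogOne_eq_mul_zpow {w : ℂ} {n : ℤ} (hn : |w.im - n| < 1) :
    qdilogOne w =
      Complex.exp (logQDilogOne (w - n * I)) * (1 - Complex.exp (2 * Real.pi * w)) ^ (-n) := by
  by_cases hw : w ∈ dilogPlane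
  · rw [qdilogOne_eq_exp hw, exp_logQDilogOne_mul_zpow hw hn]
  · -- On a cut `Im w` is an integer, and the hypothesis leaves only one possible `n`.
    simp only [dilogPlane, mem_ofPred_eq, not_forall, not_not] at hw
    obtain ⟨m, _, hm⟩ := hw
    have hmn : m = n := by
      rw [hm] at hn
      have : |m - n| < 1 := by exact_mod_cast hn
      exact sub_eq_zero.1 (Int.abs_lt_one_iff.1 this)
    rw [qdilogOne, hm, Int.floor_intCast, hmn]

theorem qdilogOne_eq_exp_logQDilogOne {w : ℂ} (hw : |w.im| < 1) :
    qdilogOne w = Complex.exp (logQDilogOne w) := by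
  rw [qdilogOne_eq_mul_zpow (n := 0) (by simpa using hw)]
  simp

theorem isOpen_abs_im_sub_lt (a : ℝ) : IsOpen {w : ℂ | |w.im - a| < 1} :=
  isOpen_lt (continuous_im.sub continuous_const).abs continuous_const

theorem analyticAt_exp_logQDilogOne {w : ℂ} {n : ℤ} (hn : |w.im - n| < 1) :
    AnalyticAt ℂ (fun v => Complex.exp (logQDilogOne (v - n * I))) w := by
  have h : DifferentiableOn ℂ (fun v => Complex.exp (logQDilogOne (v - n * I)))
      {v | |v.im - n| < 1} := by
    refine DifferentiableOn.cexp (differentiableOn_logQDilogOne.comp (by fun_prop) fun v hv => ?_)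
    simpa using hv
  exact h.analyticAt ((isOpen_abs_im_sub_lt n).mem_nhds hn)

theorem qdilogOne_eventuallyEq {w : ℂ} {n : ℤ} (hn : |w.im - n| < 1) :
    (fun v => Complex.exp (logQDilogOne (v - n * I)) *
      (1 - Complex.exp (2 * Real.pi * v)) ^ (-n)) =ᶠ[𝓝 w] qdilogOne := by
  filter_upwards [(isOpen_abs_im_sub_lt n).mem_nhds hn] with v hv
  exact (qdilogOne_eq_mul_zpow hv).symm

theorem analyticAt_one_sub_exp (w : ℂ) :
    AnalyticAt ℂ (fun v : ℂ => 1 - Complex.exp (2 * Real.pi * v)) w := by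
  fun_prop

theorem meromorphicAt_qdilogOne (w : ℂ) : MeromorphicAt qdilogOne w := by
  have hn := abs_im_sub_floor_lt w
  refine MeromorphicAt.congr ?_ ((qdilogOne_eventuallyEq hn).filter_mono nhdsWithin_le_nhds)
  exact (analyticAt_exp_logQDilogOne hn).meromorphicAt.mul
    ((analyticAt_one_sub_exp w).meromorphicAt.zpow _)

/-- The poles of `Φ₁` are the points `in` with `n ≥ 1`. -/
theorem analyticAt_qdilogOne {w : ℂ} (hw : Complex.exp (2 * Real.pi * w) ≠ 1 ∨ w.im < 1) :
    AnalyticAt ℂ qdilogOne w := by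
  have hn := abs_im_sub_floor_lt w
  refine AnalyticAt.congr ?_ (qdilogOne_eventuallyEq hn)
  refine (analyticAt_exp_logQDilogOne hn).mul ?_
  rcases hw with hw | hw
  · exact (analyticAt_one_sub_exp w).zpow (sub_ne_zero.2 hw.symm)
  · have h0 : 0 ≤ -⌊w.im⌋ := by
      have : ⌊w.im⌋ < 1 := Int.floor_lt.2 (by exact_mod_cast hw)
      omega
    obtain ⟨k, hk⟩ := Int.eq_ofNat_of_zero_le h0
    simp only [hk, zpow_natCast]
    exact (analyticAt_one_sub_exp w).pow k

theorem isOpen_qdilogStrip (b : ℂ) : IsOpen (qdilogStrip b) :=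
  isOpen_lt continuous_im.abs continuous_const

/-- The identity theorem for meromorphic functions in normal form on the plane. -/
theorem eq_of_meromorphicNFOn_of_eqOn {F G : ℂ → ℂ} (hF : MeromorphicNFOn F univ)
    (hG : MeromorphicNFOn G univ) {U : Set ℂ} (hU : IsOpen U) (hne : U.Nonempty)
    (h : EqOn F G U) : F = G := by
  have hm : MeromorphicOn (F - G) univ := hF.meromorphicOn.sub hG.meromorphicOn
  obtain ⟨x, hx⟩ := hne
  have htop : meromorphicOrderAt (F - G) x = ⊤ := by
    rw [meromorphicOrderAt_eq_top_iff]
    refine Filter.Eventually.filter_mono nhdsWithin_le_nhds ?_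
    filter_upwards [hU.mem_nhds hx] with y hy
    simp [h hy]
  ext y
  have hy : meromorphicOrderAt (F - G) y = ⊤ := by
    by_contra hy
    exact (hm.exists_meromorphicOrderAt_ne_top_iff_forall isConnected_univ).1
      ⟨⟨y, mem_univ y⟩, hy⟩ ⟨x, mem_univ x⟩ htop
  rw [meromorphicOrderAt_eq_top_iff] at hy
  refine Filter.EventuallyEq.eq_of_nhds
    (((hF (mem_univ y)).eventuallyEq_nhdsNE_iff_eventuallyEq_nhds (hG (mem_univ y))).1 ?_)
  filter_upwards [hy] with z hz
  simpa [sub_eq_zero] using hz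

/-- A meromorphic function that continues the integral computes `Φ_b` wherever it is analytic:
passing to normal form does not change it there. -/
theorem qdilog_eq_of_meromorphic {b : ℂ} {P : ℂ → ℂ} (hP : ∀ x, MeromorphicAt P x)
    (hne : (qdilogStrip b).Nonempty)
    (hstrip : ∀ x ∈ qdilogStrip b, AnalyticAt ℂ P x ∧ P x = Complex.exp (qdilogExponent b x))
    {x : ℂ} (hx : AnalyticAt ℂ P x) : qdilog b x = P x := by
  have hPu : MeromorphicOn P univ := fun x _ => hP x
  have hval : ∀ y, AnalyticAt ℂ P y → toMeromorphicNFOn P univ y = P y := fun y hy => by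
    rw [toMeromorphicNFOn_eq_toMeromorphicNFAt hPu (mem_univ y),
      toMeromorphicNFAt_eq_self.2 hy.meromorphicNFAt]
  have hcont : IsQDilogContinuation b (toMeromorphicNFOn P univ) :=
    ⟨meromorphicNFOn_toMeromorphicNFOn _ _, fun y hy => by
      rw [hval y (hstrip y hy).1, (hstrip y hy).2]⟩
  have hex : ∃ F : ℂ → ℂ, IsQDilogContinuation b F := ⟨_, hcont⟩
  have hq : qdilog b = hex.choose := by rw [qdilog, dif_pos hex]
  rw [hq, ← hval x hx]
  refine congrFun (eq_of_meromorphicNFOn_of_eqOn hex.choose_spec.1 hcont.1 (isOpen_qdilogStrip b)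
    hne fun y hy => ?_) x
  rw [hex.choose_spec.2 y hy, hcont.2 y hy]

/-! ### The product formula for `b = 1 / √N` -/

/-- Multiplication by `sinh y` makes the sum telescope. -/
theorem sinh_nat_mul_eq (N : ℕ) (y : ℂ) :
    Complex.sinh (N * y) =
      Complex.sinh y * ∑ j ∈ Finset.range N, Complex.exp ((N - 1 - 2 * j) * y) := by
  have h : ∀ j : ℕ, Complex.sinh y * Complex.exp ((N - 1 - 2 * j) * y) =
      Complex.exp ((N - 2 * j) * y) / 2 - Complex.exp ((N - 2 * (j + 1 : ℕ)) * y) / 2 := fun j => by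
    have e1 : (N - 2 * j : ℂ) * y = y + (N - 1 - 2 * j) * y := by ring
    have e2 : (N - 2 * (j + 1 : ℕ) : ℂ) * y = -y + (N - 1 - 2 * j) * y := by push_cast; ring
    rw [e1, e2, Complex.exp_add, Complex.exp_add, Complex.sinh]
    ring
  rw [Finset.mul_sum, Finset.sum_congr rfl fun j _ => h j,
    Finset.sum_range_sub' fun j : ℕ => Complex.exp ((N - 2 * j) * y) / 2, Complex.sinh]
  rw [show (N - 2 * (N : ℕ) : ℂ) * y = -(N * y) by ring]
  simp
  ring

/-- The arguments at which `Φ₁` is evaluated in the product formula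
`Φ_{1/√N}(x) = ∏ Φ₁(x / √N + i (N - 1 - 2j) / 2N)`, the product being over `0 ≤ j < N`. -/
noncomputable def qdilogNode (N : ℕ) (x : ℂ) (j : ℕ) : ℂ :=
  x / (Real.sqrt N : ℝ) + I * (N - 1 - 2 * j) / (2 * N)

theorem ofReal_sqrt_natCast_sq (N : ℕ) : ((Real.sqrt N : ℝ) : ℂ) ^ 2 = N := by
  rw [← ofReal_pow, Real.sq_sqrt (Nat.cast_nonneg N), ofReal_natCast]

theorem qdilogIntegrand_div_sqrt {N : ℕ} (hN : 1 ≤ N) (x : ℂ) {t : ℂ} (ht : Complex.sinh t ≠ 0) :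
    qdilogIntegrand (1 / (Real.sqrt N : ℝ)) x (t / (Real.sqrt N : ℝ)) =
      (Real.sqrt N : ℝ) * ∑ j ∈ Finset.range N, qdilogIntegrand 1 (qdilogNode N x j) t := by
  have hr2 := ofReal_sqrt_natCast_sq N
  have hr0 : ((Real.sqrt N : ℝ) : ℂ) ≠ 0 := by
    exact_mod_cast (Real.sqrt_pos.2 (by exact_mod_cast hN : (0 : ℝ) < N)).ne'
  have hN0 : (N : ℂ) ≠ 0 := by exact_mod_cast (by omega : N ≠ 0)
  set r : ℂ := ((Real.sqrt N : ℝ) : ℂ) with hr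
  have hsinh := sinh_nat_mul_eq N (t / N)
  rw [mul_div_cancel₀ _ hN0] at hsinh
  have hs0 : Complex.sinh (t / N) ≠ 0 := fun h => ht (by rw [hsinh, h, zero_mul])
  have hterm : ∀ j : ℕ, qdilogIntegrand 1 (qdilogNode N x j) t =
      Complex.exp (-2 * I * (x / r) * t) / (4 * Complex.sinh t ^ 2) / t *
        Complex.exp ((N - 1 - 2 * j) * (t / N)) := fun j => by
    rw [qdilogIntegrand_one, qdilogNode,
      show -2 * I * (x / r + I * (N - 1 - 2 * j) / (2 * N)) * t =
        -2 * I * (x / r) * t + (N - 1 - 2 * j) * (t / N) by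
          linear_combination (-(N - 1 - 2 * j) * t / N : ℂ) * I_sq, Complex.exp_add]
    ring
  rw [Finset.sum_congr rfl fun j _ => hterm j, ← Finset.mul_sum]
  have hS : ∑ j ∈ Finset.range N, Complex.exp ((N - 1 - 2 * j) * (t / N)) =
      Complex.sinh t / Complex.sinh (t / N) := by
    rw [hsinh, mul_div_cancel_left₀ _ hs0]
  rw [hS, qdilogIntegrand, show -2 * I * x * (t / r) = -2 * I * (x / r) * t by ring,
    show 1 / r * (t / r) = t / N by rw [← hr2]; field_simp,
    show (1 / r)⁻¹ * (t / r) = t by field_simp]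
  field_simp

theorem mem_qdilogStrip_one_div {r : ℝ} (hr : 0 < r) {x : ℂ} :
    x ∈ qdilogStrip (1 / r) ↔ |x.im| < (1 / r + r) / 2 := by
  have e : I * (1 / r + (1 / r : ℂ)⁻¹) / 2 = (((1 / r + r) / 2 : ℝ) : ℂ) * I := by
    push_cast; rw [one_div, inv_inv]; ring
  rw [qdilogStrip, mem_ofPred_eq, e, im_ofReal_mul, I_im, mul_one,
    abs_of_pos (by positivity : 0 < (1 / r + r) / 2)]

theorem abs_im_qdilogNode_lt {N : ℕ} (hN : 1 ≤ N) {x : ℂ}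
    (hx : x ∈ qdilogStrip (1 / (Real.sqrt N : ℝ))) {j : ℕ} (hj : j ∈ Finset.range N) :
    |(qdilogNode N x j).im| < 1 := by
  have hNpos : (0 : ℝ) < N := by exact_mod_cast hN
  have hr : 0 < Real.sqrt N := Real.sqrt_pos.2 hNpos
  have hr2 : Real.sqrt N ^ 2 = N := Real.sq_sqrt hNpos.le
  have hj1 : (j : ℝ) + 1 ≤ N := by exact_mod_cast Finset.mem_range.1 hj
  have hj0 : (0 : ℝ) ≤ j := Nat.cast_nonneg j
  have h1 := (mem_qdilogStrip_one_div hr).1 hx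
  have him : (qdilogNode N x j).im = x.im / Real.sqrt N + (N - 1 - 2 * j) / (2 * N) := by
    have e : qdilogNode N x j = x / (Real.sqrt N : ℝ) +
        (((N - 1 - 2 * j) / (2 * N) : ℝ) : ℂ) * I := by
      rw [qdilogNode]; push_cast; ring
    rw [e, add_im, div_ofReal_im, im_ofReal_mul, I_im, mul_one]
  have h2 : |x.im / Real.sqrt N| < (1 + N) / (2 * N) := by
    rw [abs_div, abs_of_pos hr, div_lt_iff₀ hr]
    refine h1.trans_eq ?_
    field_simp
    rw [hr2]
    ring
  have h3 : |((N : ℝ) - 1 - 2 * j) / (2 * N)| ≤ (N - 1) / (2 * N) := by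
    rw [abs_div, abs_of_pos (by positivity : (0 : ℝ) < 2 * N)]
    gcongr
    rw [abs_le]; constructor <;> linarith
  rw [him]
  calc _ ≤ _ := abs_add_le _ _
    _ < (1 + (N : ℝ)) / (2 * N) + ((N : ℝ) - 1) / (2 * N) := add_lt_add_of_lt_of_le h2 h3
    _ = 1 := by field_simp; ring

/-- The substitution `t = τ / √N` turns the kernel into `1 / (sinh (τ / N) sinh τ)`, which is a sum
of `N` exponential multiples of `1 / sinh² τ`. -/
theorem qdilogExponent_eq_sum {N : ℕ} (hN : 1 ≤ N) {x : ℂ}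
    (hx : x ∈ qdilogStrip (1 / (Real.sqrt N : ℝ))) :
    qdilogExponent (1 / (Real.sqrt N : ℝ)) x =
      ∑ j ∈ Finset.range N, logQDilogOne (qdilogNode N x j) := by
  have hr : 0 < Real.sqrt N := Real.sqrt_pos.2 (by exact_mod_cast hN)
  refine Tendsto.limUnder_eq (tendsto_const_nhds.congr' ?_)
  filter_upwards [Ioo_mem_nhdsGT (show 0 < Real.pi / Real.sqrt N by positivity)] with ε hε
  have hy : Real.sqrt N * ε ∈ Ioo 0 Real.pi :=
    ⟨mul_pos hr hε.1, by rw [mul_comm]; exact (lt_div_iff₀ hr).1 hε.2⟩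
  have h1 := Measure.integral_comp_div
    (fun t : ℝ => qdilogIntegrand (1 / (Real.sqrt N : ℝ)) x (t + ε * I)) (Real.sqrt N)
  have h2 : ∀ t : ℝ, qdilogIntegrand (1 / (Real.sqrt N : ℝ)) x ((t / Real.sqrt N : ℝ) + ε * I) =
      (Real.sqrt N : ℝ) * ∑ j ∈ Finset.range N,
        qdilogIntegrand 1 (qdilogNode N x j) (t + (Real.sqrt N * ε : ℝ) * I) := fun t => by
    rw [← qdilogIntegrand_div_sqrt hN x (sinh_ne_zero_of_im_mem (by simpa using hy))]
    congr 1
    have : ((Real.sqrt N : ℝ) : ℂ) ≠ 0 := by exact_mod_cast hr.ne'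
    push_cast
    field_simp
  simp_rw [h2] at h1
  rw [integral_const_mul, integral_finsetSum _ fun j hj =>
    integrable_qdilogIntegrand_one (abs_im_qdilogNode_lt hN hx hj) hy, abs_of_pos hr,
    real_smul] at h1
  rw [← mul_left_cancel₀ (by exact_mod_cast hr.ne') h1]
  exact Finset.sum_congr rfl fun j hj =>
    (integral_qdilogIntegrand_one (abs_im_qdilogNode_lt hN hx hj) hy).symm

theorem differentiable_qdilogNode (N : ℕ) (j : ℕ) :
    Differentiable ℂ fun x => qdilogNode N x j := by
  unfold qdilogNode; fun_prop

/-- The product formula holds in the strip, where it is the exponential of the previous lemma, and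
away from the poles of the factors by meromorphic continuation. -/
theorem qdilog_eq_prod {N : ℕ} (hN : 1 ≤ N) {x : ℂ}
    (hx : ∀ j ∈ Finset.range N, Complex.exp (2 * Real.pi * qdilogNode N x j) ≠ 1 ∨
      (qdilogNode N x j).im < 1) :
    qdilog (1 / (Real.sqrt N : ℝ)) x = ∏ j ∈ Finset.range N, qdilogOne (qdilogNode N x j) := by
  have hr : 0 < Real.sqrt N := Real.sqrt_pos.2 (by exact_mod_cast hN)
  have hnode : ∀ x j, AnalyticAt ℂ (fun x => qdilogNode N x j) x := fun x j =>
    (differentiable_qdilogNode N j).analyticAt x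
  have han : ∀ x, (∀ j ∈ Finset.range N, Complex.exp (2 * Real.pi * qdilogNode N x j) ≠ 1 ∨
      (qdilogNode N x j).im < 1) →
      AnalyticAt ℂ (fun x => ∏ j ∈ Finset.range N, qdilogOne (qdilogNode N x j)) x :=
    fun x hx => Finset.analyticAt_fun_prod _ fun j hj =>
      (analyticAt_qdilogOne (hx j hj)).comp_of_eq (hnode x j) rfl
  refine qdilog_eq_of_meromorphic
    (P := fun x => ∏ j ∈ Finset.range N, qdilogOne (qdilogNode N x j)) (fun y => ?_) ?_ ?_
    (han x hx)
  · exact MeromorphicAt.fun_prod fun j _ => (meromorphicAt_qdilogOne _).comp_analyticAt (hnode y j)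
  · exact ⟨0, (mem_qdilogStrip_one_div hr).2 (by simp only [zero_im, abs_zero]; positivity)⟩
  · intro y hy
    refine ⟨han y fun j hj => Or.inr (abs_lt.1 (abs_im_qdilogNode_lt hN hy hj)).2, ?_⟩
    rw [qdilogExponent_eq_sum hN hy, Complex.exp_sum]
    exact Finset.prod_congr rfl fun j hj =>
      qdilogOne_eq_exp_logQDilogOne (abs_im_qdilogNode_lt hN hy hj)

/-! ### Distribution relations -/

theorem exp_two_pi_mul_of_im_eq_int {w : ℂ} {n : ℤ} (h : w.im = n) :
    Complex.exp (2 * Real.pi * w) = (Real.exp (2 * Real.pi * w.re) : ℝ) := by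
  have e : w - n * I = (w.re : ℝ) := by
    apply Complex.ext <;> simp [h]
  rw [← exp_two_pi_mul_sub_int_mul_I w n, e]
  push_cast; rfl

theorem mem_dilogPlane_iff {w : ℂ} :
    w ∈ dilogPlane ↔ 1 - Complex.exp (2 * Real.pi * w) ∈ slitPlane := by
  refine ⟨one_sub_exp_mem_slitPlane, fun h n hre him => ?_⟩
  rw [exp_two_pi_mul_of_im_eq_int him] at h
  have h1 : 1 ≤ Real.exp (2 * Real.pi * w.re) := Real.one_le_exp (by positivity)
  rw [← ofReal_one, ← ofReal_sub, ofReal_mem_slitPlane] at h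
  linarith

theorem isOpen_dilogPlane : IsOpen dilogPlane := by
  have : dilogPlane = (fun w : ℂ => 1 - Complex.exp (2 * Real.pi * w)) ⁻¹' slitPlane := by
    ext w; exact mem_dilogPlane_iff
  rw [this]
  exact isOpen_slitPlane.preimage (by fun_prop)

/-- The points `(w + ik) / N`, for which `e^{2π(w + ik)/N}` runs through the `N`-th roots of
`e^{2πw}` when `0 ≤ k < N`. -/
noncomputable def cyclicNode (N : ℕ) (w : ℂ) (k : ℕ) : ℂ := (w + k * I) / N

theorem exp_cyclicNode (N : ℕ) (w : ℂ) (k : ℕ) :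
    Complex.exp (2 * Real.pi * cyclicNode N w k) =
      Complex.exp (2 * Real.pi * I / N) ^ k * Complex.exp (2 * Real.pi * w / N) := by
  rw [← Complex.exp_nat_mul, ← Complex.exp_add, cyclicNode]
  congr 1; ring

theorem im_cyclicNode (N : ℕ) (w : ℂ) (k : ℕ) : (cyclicNode N w k).im = (w.im + k) / N := by
  rw [cyclicNode, div_natCast_im]; simp

theorem re_cyclicNode (N : ℕ) (w : ℂ) (k : ℕ) : (cyclicNode N w k).re = w.re / N := by
  rw [cyclicNode, div_natCast_re]; simp

theorem cyclicNode_mem_dilogPlane {N : ℕ} (hN : N ≠ 0) {w : ℂ} (hw : w ∈ dilogPlane) (k : ℕ) :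
    cyclicNode N w k ∈ dilogPlane := by
  have hNpos : (0 : ℝ) < N := by exact_mod_cast Nat.pos_of_ne_zero hN
  intro n hre him
  rw [re_cyclicNode] at hre
  rw [im_cyclicNode, div_eq_iff hNpos.ne'] at him
  refine hw (n * N - k) ?_ (by push_cast; linarith)
  by_contra h
  exact absurd hre (not_le.2 (div_neg_of_neg_of_pos (not_le.1 h) hNpos))

theorem hasDerivAt_cyclicNode (N : ℕ) (w : ℂ) (k : ℕ) :
    HasDerivAt (fun w => cyclicNode N w k) (1 / N) w :=
  ((hasDerivAt_id w).add_const _).div_const _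

theorem cyclicNode_sub_ofReal (N : ℕ) (w : ℂ) (k : ℕ) (r : ℝ) :
    cyclicNode N (w - r) k = cyclicNode N w k - (r / N : ℝ) := by
  rw [cyclicNode, cyclicNode]; push_cast; ring

theorem prod_one_sub_exp_cyclicNode {N : ℕ} (hN : N ≠ 0) (w : ℂ) :
    ∏ k ∈ Finset.range N, (1 - Complex.exp (2 * Real.pi * cyclicNode N w k)) =
      1 - Complex.exp (2 * Real.pi * w) := by
  have hN0 : (N : ℂ) ≠ 0 := by exact_mod_cast hN
  have hx : Complex.exp (2 * Real.pi * w / N) ^ N = Complex.exp (2 * Real.pi * w) := by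
    rw [← Complex.exp_nat_mul, mul_div_cancel₀ _ hN0]
  have h := congrArg (Polynomial.eval 1)
    (X_pow_sub_C_eq_prod (Complex.isPrimitiveRoot_exp N hN) (Nat.pos_of_ne_zero hN) hx)
  simpa [Polynomial.eval_prod, exp_cyclicNode] using h.symm

theorem tendsto_div_natCast_atTop {N : ℕ} (hN : N ≠ 0) :
    Tendsto (fun r : ℝ => r / N) atTop atTop :=
  tendsto_id.atTop_div_const (by exact_mod_cast Nat.pos_of_ne_zero hN)

/-- Both sides have the same exponential, hence the same derivative, and both tend to zero at the
left. -/
theorem sum_log_one_sub_exp_cyclicNode {N : ℕ} (hN : N ≠ 0) {w : ℂ} (hw : w ∈ dilogPlane) :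
    ∑ k ∈ Finset.range N, Complex.log (1 - Complex.exp (2 * Real.pi * cyclicNode N w k)) =
      Complex.log (1 - Complex.exp (2 * Real.pi * w)) := by
  rw [← sub_eq_zero]
  set f : ℂ → ℂ := fun w =>
    ∑ k ∈ Finset.range N, Complex.log (1 - Complex.exp (2 * Real.pi * cyclicNode N w k)) -
      Complex.log (1 - Complex.exp (2 * Real.pi * w)) with hf
  have hexp : ∀ v ∈ dilogPlane, Complex.exp (f v) = 1 := fun v hv => by
    rw [hf]
    simp only
    rw [Complex.exp_sub, Complex.exp_sum, Complex.exp_log (exp_two_pi_mul_ne_one hv),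
      Finset.prod_congr rfl fun k _ =>
        Complex.exp_log (exp_two_pi_mul_ne_one (cyclicNode_mem_dilogPlane hN hv k)),
      prod_one_sub_exp_cyclicNode hN, div_self (exp_two_pi_mul_ne_one hv)]
  have hdiff : ∀ v ∈ dilogPlane, DifferentiableAt ℂ f v := fun v hv =>
    (DifferentiableAt.fun_sum fun k _ => ((hasDerivAt_log_one_sub_exp
      (cyclicNode_mem_dilogPlane hN hv k)).comp v
        (hasDerivAt_cyclicNode N v k)).differentiableAt).sub
      (hasDerivAt_log_one_sub_exp hv).differentiableAt
  refine eq_zero_of_hasDerivAt_zero_of_tendsto (f := f) (fun r hr => ?_) ?_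
  · have hv := sub_ofReal_mem_dilogPlane hw hr
    have h1 := (hdiff _ hv).hasDerivAt
    have h2 : HasDerivAt (fun v => Complex.exp (f v)) 0 (w - r) :=
      (hasDerivAt_const (w - r : ℂ) (1 : ℂ)).congr_of_eventuallyEq (by
        filter_upwards [isOpen_dilogPlane.mem_nhds hv] with v hv using hexp v hv)
    have h3 := h1.cexp.unique h2
    rw [hexp _ hv, one_mul] at h3
    rwa [h3] at h1
  · have h1 : Tendsto (fun r : ℝ => ∑ k ∈ Finset.range N,
        Complex.log (1 - Complex.exp (2 * Real.pi * cyclicNode N (w - r) k))) atTop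
        (𝓝 (∑ k ∈ Finset.range N, 0)) := by
      refine tendsto_finsetSum _ fun k _ => ?_
      simp_rw [cyclicNode_sub_ofReal]
      exact (tendsto_log_one_sub_exp_sub (cyclicNode N w k)).comp (tendsto_div_natCast_atTop hN)
    simpa [hf] using h1.sub (tendsto_log_one_sub_exp_sub w)

/-- The distribution relation of the dilogarithm. -/
theorem sum_dilog_exp_cyclicNode {N : ℕ} (hN : N ≠ 0) {w : ℂ} (hw : w ∈ dilogPlane) :
    ∑ k ∈ Finset.range N, dilog (Complex.exp (2 * Real.pi * cyclicNode N w k)) =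
      dilog (Complex.exp (2 * Real.pi * w)) / N := by
  rw [← sub_eq_zero]
  refine eq_zero_of_hasDerivAt_zero_of_tendsto (f := fun w =>
    ∑ k ∈ Finset.range N, dilog (Complex.exp (2 * Real.pi * cyclicNode N w k)) -
      dilog (Complex.exp (2 * Real.pi * w)) / N) (fun r hr => ?_) ?_
  · have hv := sub_ofReal_mem_dilogPlane hw hr
    refine ((HasDerivAt.fun_sum fun k _ => (hasDerivAt_dilog_exp
      (cyclicNode_mem_dilogPlane hN hv k)).comp (w - r : ℂ) (hasDerivAt_cyclicNode N _ k)).sub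
      ((hasDerivAt_dilog_exp hv).div_const _)).congr_deriv ?_
    rw [← Finset.sum_mul, ← Finset.mul_sum, sum_log_one_sub_exp_cyclicNode hN hv]
    ring
  · have h1 : Tendsto (fun r : ℝ => ∑ k ∈ Finset.range N,
        dilog (Complex.exp (2 * Real.pi * cyclicNode N (w - r) k))) atTop
        (𝓝 (∑ k ∈ Finset.range N, 0)) := by
      refine tendsto_finsetSum _ fun k _ => ?_
      simp_rw [cyclicNode_sub_ofReal]
      exact (tendsto_dilog_exp_sub (cyclicNode N w k)).comp (tendsto_div_natCast_atTop hN)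
    simpa using h1.sub ((tendsto_dilog_exp_sub w).div_const (N : ℂ))

/-- The sum `∑ (k / N) log (1 - e^{2π(w + ik)/N})`, a logarithm of the cyclic dilogarithm. The term
`k = 0` vanishes; it is included so that all sums are over `0 ≤ k < N`. -/
noncomputable def logCyclicDilog (N : ℕ) (w : ℂ) : ℂ :=
  ∑ k ∈ Finset.range N,
    (k / N : ℂ) * Complex.log (1 - Complex.exp (2 * Real.pi * cyclicNode N w k))

theorem sum_dilogLogQDilogOne_cyclicNode {N : ℕ} (hN : N ≠ 0) {w : ℂ} (hw : w ∈ dilogPlane) :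
    ∑ k ∈ Finset.range N, dilogLogQDilogOne (cyclicNode N w k - I) =
      I / (2 * Real.pi * N) * dilog (Complex.exp (2 * Real.pi * w)) +
        (1 + I * w / N) * Complex.log (1 - Complex.exp (2 * Real.pi * w)) -
          logCyclicDilog N w := by
  have hterm : ∀ k : ℕ, dilogLogQDilogOne (cyclicNode N w k - I) =
      I / (2 * Real.pi) * dilog (Complex.exp (2 * Real.pi * cyclicNode N w k)) +
        (1 + I * w / N) * Complex.log (1 - Complex.exp (2 * Real.pi * cyclicNode N w k)) -
        (k / N : ℂ) * Complex.log (1 - Complex.exp (2 * Real.pi * cyclicNode N w k)) := fun k => by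
    have e := exp_two_pi_mul_sub_int_mul_I (cyclicNode N w k) 1
    rw [Int.cast_one, one_mul] at e
    rw [dilogLogQDilogOne, e]
    have e2 : I * (cyclicNode N w k - I) = 1 + I * w / N - k / N := by
      rw [cyclicNode]; linear_combination (k / N - 1 : ℂ) * I_sq
    rw [← mul_assoc I, e2]; ring
  rw [Finset.sum_congr rfl fun k _ => hterm k, Finset.sum_sub_distrib, Finset.sum_add_distrib,
    ← Finset.mul_sum, ← Finset.mul_sum, sum_dilog_exp_cyclicNode hN hw,
    sum_log_one_sub_exp_cyclicNode hN hw, logCyclicDilog]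
  ring

/-! ### Continuity from below on the cuts -/

theorem continuousWithinAt_log_upper {z : ℂ} (hz : z ≠ 0) :
    ContinuousWithinAt Complex.log {z | 0 ≤ z.im} z := by
  by_cases h : z ∈ slitPlane
  · exact (continuousAt_clog h).continuousWithinAt
  · rw [mem_slitPlane_iff, not_or, not_lt, not_not] at h
    refine continuousWithinAt_log_of_re_neg_of_im_zero (lt_of_le_of_ne h.1 fun h0 => hz ?_) h.2
    exact Complex.ext h0 h.2

/-- On the cut `(1, ∞)` the principal dilogarithm is continuous from below. Keeping the modulus of
the argument fixed makes `|log |1 - tu||` a dominating function, up to constants. -/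
theorem continuousWithinAt_dilog_lower {u : ℝ} (hu : 1 < u) :
    ContinuousWithinAt dilog {v | v.im ≤ 0 ∧ ‖v‖ = u} (u : ℂ) := by
  have hu0 : 0 < u := by linarith
  refine ContinuousWithinAt.neg (intervalIntegral.continuousWithinAt_of_dominated_interval
    (F := fun (v : ℂ) (t : ℝ) => Complex.log (1 - t * v) / t)
    (bound := fun t => 3 / 2 * u + 2 * u * (|Real.log (1 - u * t)| + (Real.log (1 + u) + Real.pi)))
    ?_ ?_ ?_ ?_)
  · refine Eventually.of_forall fun v => Measurable.aestronglyMeasurable ?_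
    exact (Measurable.clog (by fun_prop)).div (by fun_prop)
  · filter_upwards [self_mem_nhdsWithin] with v hv
    filter_upwards [Measure.ae_ne volume (1 / u)] with t ht1 ht
    rw [uIoc_of_le zero_le_one] at ht
    have hn : ‖(t : ℂ) * v‖ = u * t := by
      rw [norm_mul, hv.2, norm_real, Real.norm_of_nonneg ht.1.le, mul_comm]
    have hlog0 : 0 ≤ Real.log (1 + u) := Real.log_nonneg (by linarith)
    have hpi := Real.pi_pos
    rw [norm_div, norm_real, Real.norm_of_nonneg ht.1.le, div_le_iff₀ ht.1]
    rcases le_total (u * t) (1 / 2) with h | h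
    · have h1 := Complex.norm_log_one_add_half_le_self (z := -(t * v))
        (by rw [norm_neg, hn]; exact h)
      rw [norm_neg, hn, ← sub_eq_add_neg] at h1
      have : 0 ≤ 2 * u * (|Real.log (1 - u * t)| + (Real.log (1 + u) + Real.pi)) * t := by
        have := ht.1
        positivity
      nlinarith
    · have hne : 1 - u * t ≠ 0 := fun h0 => ht1 (by field_simp; linarith)
      have hlow : |1 - u * t| ≤ ‖1 - (t : ℂ) * v‖ := by
        have := abs_norm_sub_norm_le (1 : ℂ) (t * v)
        rwa [hn, norm_one] at this
      have hup : ‖1 - (t : ℂ) * v‖ ≤ 1 + u := by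
        have := norm_sub_le (1 : ℂ) (t * v)
        rw [hn, norm_one] at this
        nlinarith [ht.2]
      have hpos : 0 < |1 - u * t| := abs_pos.2 hne
      have hl1 : Real.log (1 - u * t) ≤ Real.log ‖1 - (t : ℂ) * v‖ := by
        rw [← Real.log_abs]; exact Real.log_le_log hpos hlow
      have hl2 : Real.log ‖1 - (t : ℂ) * v‖ ≤ Real.log (1 + u) :=
        Real.log_le_log (hpos.trans_le hlow) hup
      have hb : |Real.log ‖1 - (t : ℂ) * v‖| ≤ |Real.log (1 - u * t)| + Real.log (1 + u) := by
        have := neg_abs_le (Real.log (1 - u * t))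
        have := abs_nonneg (Real.log (1 - u * t))
        rw [abs_le]; constructor <;> linarith
      have hnorm : ‖Complex.log (1 - t * v)‖ ≤
          |Real.log (1 - u * t)| + (Real.log (1 + u) + Real.pi) := by
        have h1 := Complex.norm_le_abs_re_add_abs_im (Complex.log (1 - t * v))
        rw [Complex.log_re, Complex.log_im] at h1
        linarith [Complex.abs_arg_le_pi (1 - t * v)]
      have h2 : 0 ≤ |Real.log (1 - u * t)| + (Real.log (1 + u) + Real.pi) := by positivity
      have h3 : 0 ≤ 3 / 2 * u * t := by have := ht.1; positivity
      nlinarith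
  · have h1 : IntervalIntegrable (fun t : ℝ => Real.log (1 - u * t)) volume 0 1 := by
      have h0 : IntervalIntegrable Real.log volume 1 (1 - u) :=
        intervalIntegral.intervalIntegrable_log'
      have := (h0.comp_sub_left 1).comp_mul_left (c := u)
      simpa [hu0.ne'] using this
    exact intervalIntegrable_const.add
      ((h1.abs.add intervalIntegrable_const).const_mul (2 * u))
  · filter_upwards [Measure.ae_ne volume (1 / u)] with t ht1 ht
    rw [uIoc_of_le zero_le_one] at ht
    have hne : (1 - t * u : ℂ) ≠ 0 := by
      intro h0
      have h0' : 1 - t * u = 0 := by exact_mod_cast h0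
      exact ht1 (by field_simp; linarith)
    refine ContinuousWithinAt.div_const ?_ _
    refine (continuousWithinAt_log_upper hne).comp (f := fun v : ℂ => 1 - (t : ℂ) * v)
      (by fun_prop) fun v hv => ?_
    have := mul_nonneg ht.1.le (neg_nonneg.2 hv.1)
    simp
    linarith

theorem exists_of_notMem_dilogPlane {w : ℂ} (hw : w ∉ dilogPlane) :
    ∃ n : ℤ, 0 ≤ w.re ∧ w.im = n := by
  simp only [dilogPlane, mem_ofPred_eq, not_forall, not_not] at hw
  obtain ⟨n, h1, h2⟩ := hw
  exact ⟨n, h1, h2⟩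

theorem tendsto_sub_ofReal_mul_I (w : ℂ) :
    Tendsto (fun δ : ℝ => w - δ * I) (𝓝[>] 0) (𝓝 w) := by
  have : ContinuousAt (fun δ : ℝ => w - δ * I) 0 := by fun_prop
  simpa [ContinuousAt] using this.tendsto.mono_left nhdsWithin_le_nhds

/-- A point of a cut is approached from below, where the exponential `e^{2πw}` is rotated into the
lower half plane. -/
theorem exp_two_pi_mul_sub_mem_lower {w : ℂ} {n : ℤ} (h : w.im = n) :
    ∀ᶠ δ : ℝ in 𝓝[>] 0, Complex.exp (2 * Real.pi * (w - δ * I)) ∈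
      {v : ℂ | v.im ≤ 0 ∧ ‖v‖ = Real.exp (2 * Real.pi * w.re)} := by
  filter_upwards [Ioo_mem_nhdsGT (show (0 : ℝ) < 1 / 2 by norm_num)] with δ hδ
  have e : Complex.exp (2 * Real.pi * (w - δ * I)) =
      (Real.exp (2 * Real.pi * w.re) : ℝ) * Complex.exp ((-(2 * Real.pi * δ) : ℝ) * I) := by
    rw [← exp_two_pi_mul_of_im_eq_int h, ← Complex.exp_add]
    push_cast; ring_nf
  refine ⟨?_, ?_⟩
  · rw [e, im_ofReal_mul, Complex.exp_ofReal_mul_I_im, Real.sin_neg]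
    have : 0 ≤ Real.sin (2 * Real.pi * δ) :=
      Real.sin_nonneg_of_nonneg_of_le_pi (by have := hδ.1; positivity)
        (by nlinarith [hδ.2, Real.pi_pos])
    have := mul_nonneg (Real.exp_pos (2 * Real.pi * w.re)).le this
    linarith
  · rw [e, norm_mul, norm_real, Complex.norm_exp_ofReal_mul_I, mul_one,
      Real.norm_of_nonneg (Real.exp_pos _).le]

theorem tendsto_log_one_sub_exp_lower {w : ℂ} (hw : Complex.exp (2 * Real.pi * w) ≠ 1) :
    Tendsto (fun δ : ℝ => Complex.log (1 - Complex.exp (2 * Real.pi * (w - δ * I)))) (𝓝[>] 0)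
      (𝓝 (Complex.log (1 - Complex.exp (2 * Real.pi * w)))) := by
  by_cases h : w ∈ dilogPlane
  · exact (hasDerivAt_log_one_sub_exp h).continuousAt.tendsto.comp (tendsto_sub_ofReal_mul_I w)
  · obtain ⟨n, _, hn⟩ := exists_of_notMem_dilogPlane h
    refine (continuousWithinAt_log_upper (sub_ne_zero.2 hw.symm)).tendsto.comp
      (tendsto_nhdsWithin_iff.2 ⟨?_, ?_⟩)
    · have : Continuous fun v : ℂ => 1 - Complex.exp (2 * Real.pi * v) := by fun_prop
      exact (this.tendsto w).comp (tendsto_sub_ofReal_mul_I w)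
    · filter_upwards [exp_two_pi_mul_sub_mem_lower hn] with δ hδ
      simpa using hδ.1

theorem tendsto_dilog_exp_lower {w : ℂ} (hw : Complex.exp (2 * Real.pi * w) ≠ 1) :
    Tendsto (fun δ : ℝ => dilog (Complex.exp (2 * Real.pi * (w - δ * I)))) (𝓝[>] 0)
      (𝓝 (dilog (Complex.exp (2 * Real.pi * w)))) := by
  by_cases h : w ∈ dilogPlane
  · exact (hasDerivAt_dilog_exp h).continuousAt.tendsto.comp (tendsto_sub_ofReal_mul_I w)
  · obtain ⟨n, hre, hn⟩ := exists_of_notMem_dilogPlane h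
    have hu : 1 < Real.exp (2 * Real.pi * w.re) := by
      refine Real.one_lt_exp_iff.2 (mul_pos (by positivity) (lt_of_le_of_ne hre fun h0 => hw ?_))
      rw [exp_two_pi_mul_of_im_eq_int hn, ← h0]; simp
    have hlim : Tendsto (fun δ : ℝ => Complex.exp (2 * Real.pi * (w - δ * I))) (𝓝[>] 0)
        (𝓝 (Complex.exp (2 * Real.pi * w))) := by
      have : Continuous fun v : ℂ => Complex.exp (2 * Real.pi * v) := by fun_prop
      exact (this.tendsto w).comp (tendsto_sub_ofReal_mul_I w)
    rw [exp_two_pi_mul_of_im_eq_int hn] at hlim ⊢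
    exact (continuousWithinAt_dilog_lower hu).tendsto.comp
      (tendsto_nhdsWithin_iff.2 ⟨hlim, exp_two_pi_mul_sub_mem_lower hn⟩)

theorem eventually_sub_mem_dilogPlane {w : ℂ} {n : ℤ} (h : w.im = n) :
    ∀ᶠ δ : ℝ in 𝓝[>] 0, w - δ * I ∈ dilogPlane := by
  filter_upwards [Ioo_mem_nhdsGT (show (0 : ℝ) < 1 by norm_num)] with δ hδ m _ him
  have h1 : (n : ℝ) - δ = m := by simpa [h] using him
  have h2 : (0 : ℝ) < (n - m : ℤ) := by push_cast; linarith [hδ.1]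
  have h3 : ((n - m : ℤ) : ℝ) < 1 := by push_cast; linarith [hδ.2]
  have h4 : 0 < n - m := by exact_mod_cast h2
  have h5 : n - m < 1 := by exact_mod_cast h3
  omega

/-! ### Evaluation of the product -/

/-- Under the hypothesis of either formula the factors of the product and of the cyclic dilogarithm
have no singularity, except that `w = 0` and `k = 0` is possible; there the factor of the product
is `Φ₁(-i) = 0` and the term of the cyclic dilogarithm is absent. -/
theorem eq_zero_of_exp_cyclicNode_eq_one {N : ℕ} (hN : N ≠ 0) {w : ℂ}
    (hw : Complex.exp (2 * Real.pi * w) ≠ 1 ∨ w ∈ slitPlaneOne) {k : ℕ} (hk : k < N)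
    (h : Complex.exp (2 * Real.pi * cyclicNode N w k) = 1) : w = 0 ∧ k = 0 := by
  have hN0 : (N : ℂ) ≠ 0 := by exact_mod_cast hN
  have hpi : (Real.pi : ℂ) ≠ 0 := by exact_mod_cast Real.pi_ne_zero
  obtain ⟨n, hn⟩ := Complex.exp_eq_one_iff.1 h
  have h1 : cyclicNode N w k = n * I := by
    apply mul_left_cancel₀ (mul_ne_zero two_ne_zero hpi)
    rw [hn]; ring
  have h2 : w = ((n * N - k : ℤ) : ℂ) * I := by
    rw [cyclicNode, div_eq_iff hN0] at h1
    push_cast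
    linear_combination h1
  have him : w.im = (n * N - k : ℤ) := by
    rw [h2]
    simp only [mul_im, intCast_re, intCast_im, I_im, I_re, mul_one, mul_zero, add_zero]
  have hre : w.re = 0 := by
    rw [h2]
    simp only [mul_re, intCast_re, intCast_im, I_im, I_re, mul_zero, zero_mul, sub_zero]
  have hm : (n * N - k : ℤ) = 0 := by
    by_contra hm
    rcases hw with hw | hw
    · exact hw (by rw [exp_two_pi_mul_of_im_eq_int him, hre]; simp)
    · exact hw _ hm hre.ge him
  refine ⟨by rw [h2, hm]; simp, ?_⟩
  have : (N : ℤ) ∣ k := ⟨n, by linarith⟩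
  exact Nat.eq_zero_of_dvd_of_lt (by exact_mod_cast this) hk

theorem exp_cyclicNode_sub_I_ne_one_or {N : ℕ} (hN : N ≠ 0) {w : ℂ}
    (hw : Complex.exp (2 * Real.pi * w) ≠ 1 ∨ w ∈ slitPlaneOne) {k : ℕ} (hk : k < N) :
    Complex.exp (2 * Real.pi * (cyclicNode N w k - I)) ≠ 1 ∨ (cyclicNode N w k - I).im < 1 := by
  have e := exp_two_pi_mul_sub_int_mul_I (cyclicNode N w k) 1
  rw [Int.cast_one, one_mul] at e
  rw [e]
  by_cases h : Complex.exp (2 * Real.pi * cyclicNode N w k) = 1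
  · obtain ⟨rfl, rfl⟩ := eq_zero_of_exp_cyclicNode_eq_one hN hw hk h
    right
    simp [cyclicNode]
  · exact Or.inl h

theorem continuousAt_prod_qdilogOne {N : ℕ} (hN : N ≠ 0) {w : ℂ}
    (hw : Complex.exp (2 * Real.pi * w) ≠ 1 ∨ w ∈ slitPlaneOne) :
    ContinuousAt (fun w => ∏ k ∈ Finset.range N, qdilogOne (cyclicNode N w k - I)) w := by
  refine tendsto_finsetProd _ fun k hk => ?_
  have h := (analyticAt_qdilogOne
    (exp_cyclicNode_sub_I_ne_one_or hN hw (Finset.mem_range.1 hk))).continuousAt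
  exact ContinuousAt.comp (f := fun w => cyclicNode N w k - I) h
    ((hasDerivAt_cyclicNode N w k).continuousAt.sub continuousAt_const)

theorem qdilogNode_eq {N : ℕ} (hN : N ≠ 0) (z : ℂ) {j : ℕ} (hj : j < N) :
    qdilogNode N (z - I * (1 / (Real.sqrt N : ℝ) + (1 / (Real.sqrt N : ℝ) : ℂ)⁻¹) / 2) j =
      cyclicNode N ((Real.sqrt N : ℝ) * z) (N - 1 - j) - I := by
  have hr0 : ((Real.sqrt N : ℝ) : ℂ) ≠ 0 := by
    exact_mod_cast (Real.sqrt_pos.2 (by exact_mod_cast Nat.pos_of_ne_zero hN)).ne'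
  have hr2 := ofReal_sqrt_natCast_sq N
  rw [qdilogNode, cyclicNode, Nat.cast_sub (by omega), Nat.cast_sub (by omega), ← hr2]
  push_cast
  field_simp
  ring

theorem qdilog_eq_prod_cyclicNode {N : ℕ} (hN : 1 ≤ N) {z : ℂ}
    (hw : Complex.exp (2 * Real.pi * ((Real.sqrt N : ℝ) * z)) ≠ 1 ∨
      (Real.sqrt N : ℝ) * z ∈ slitPlaneOne) :
    qdilog (1 / (Real.sqrt N : ℝ))
        (z - I * (1 / (Real.sqrt N : ℝ) + (1 / (Real.sqrt N : ℝ) : ℂ)⁻¹) / 2) =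
      ∏ k ∈ Finset.range N, qdilogOne (cyclicNode N ((Real.sqrt N : ℝ) * z) k - I) := by
  have hN' : N ≠ 0 := by omega
  rw [qdilog_eq_prod hN fun j hj => ?_, ← Finset.prod_range_reflect
    (fun k => qdilogOne (cyclicNode N ((Real.sqrt N : ℝ) * z) k - I))]
  · exact Finset.prod_congr rfl fun j hj => by rw [qdilogNode_eq hN' z (Finset.mem_range.1 hj)]
  · rw [qdilogNode_eq hN' z (Finset.mem_range.1 hj)]
    exact exp_cyclicNode_sub_I_ne_one_or hN' hw (by omega)

theorem prod_qdilogOne_eq_exp {N : ℕ} (hN : N ≠ 0) {w : ℂ} (hw : w ∈ dilogPlane) :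
    ∏ k ∈ Finset.range N, qdilogOne (cyclicNode N w k - I) =
      Complex.exp (I / (2 * Real.pi * N) * dilog (Complex.exp (2 * Real.pi * w)) +
        (1 + I * w / N) * Complex.log (1 - Complex.exp (2 * Real.pi * w)) -
          logCyclicDilog N w) := by
  rw [← sum_dilogLogQDilogOne_cyclicNode hN hw, Complex.exp_sum]
  refine Finset.prod_congr rfl fun k _ => qdilogOne_eq_exp ?_
  simpa using sub_int_mul_I_mem_dilogPlane (cyclicNode_mem_dilogPlane hN hw k) 1

theorem tendsto_logCyclicDilog_lower {N : ℕ} (hN : N ≠ 0) {w : ℂ}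
    (hw : Complex.exp (2 * Real.pi * w) ≠ 1 ∨ w ∈ slitPlaneOne) :
    Tendsto (fun δ : ℝ => logCyclicDilog N (w - δ * I)) (𝓝[>] 0) (𝓝 (logCyclicDilog N w)) := by
  have hNpos : (0 : ℝ) < N := by exact_mod_cast Nat.pos_of_ne_zero hN
  have hdiv : Tendsto (fun δ : ℝ => δ / N) (𝓝[>] 0) (𝓝[>] 0) := by
    refine tendsto_nhdsWithin_iff.2 ⟨?_, ?_⟩
    · have : Continuous fun δ : ℝ => δ / N := by fun_prop
      simpa using (this.tendsto 0).mono_left nhdsWithin_le_nhds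
    · filter_upwards [self_mem_nhdsWithin] with δ hδ using div_pos hδ hNpos
  refine tendsto_finsetSum _ fun k hk => ?_
  by_cases h : Complex.exp (2 * Real.pi * cyclicNode N w k) = 1
  · obtain ⟨_, rfl⟩ := eq_zero_of_exp_cyclicNode_eq_one hN hw (Finset.mem_range.1 hk) h
    simp
  · have e : ∀ δ : ℝ, cyclicNode N (w - δ * I) k = cyclicNode N w k - (δ / N : ℝ) * I := fun δ => by
      rw [cyclicNode, cyclicNode]; push_cast; ring
    simp_rw [e]
    exact ((tendsto_log_one_sub_exp_lower h).comp hdiv).const_mul _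

theorem cyclicDilog_eq_exp {N : ℕ} (hN : N ≠ 0) {w : ℂ}
    (hw : Complex.exp (2 * Real.pi * w) ≠ 1 ∨ w ∈ slitPlaneOne) :
    cyclicDilog N (Complex.exp (2 * Real.pi * w / N)) (Complex.exp (2 * Real.pi * I / N)) =
      Complex.exp (logCyclicDilog N w) := by
  have hsub : Finset.Icc 1 (N - 1) ⊆ Finset.range N := fun k hk => by
    rw [Finset.mem_Icc] at hk
    rw [Finset.mem_range]; omega
  rw [logCyclicDilog, ← Finset.sum_subset hsub, Complex.exp_sum, cyclicDilog]
  · refine Finset.prod_congr rfl fun k hk => ?_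
    have hne : 1 - Complex.exp (2 * Real.pi * cyclicNode N w k) ≠ 0 := fun h0 => by
      have := eq_zero_of_exp_cyclicNode_eq_one hN hw (Finset.mem_range.1 (hsub hk))
        (sub_eq_zero.1 h0).symm
      have := (Finset.mem_Icc.1 hk).1
      omega
    rw [← exp_cyclicNode, cpow_def_of_ne_zero hne, mul_comm]
  · intro k hk hk'
    have : k = 0 := by
      rw [Finset.mem_range] at hk
      rw [Finset.mem_Icc] at hk'
      omega
    simp [this]

/-- An identity for the product that holds off all cuts extends to a cut if its right-hand side is
continuous there from below. -/
theorem prod_qdilogOne_eq_of_tendsto {N : ℕ} (hN : N ≠ 0) {R : ℂ → ℂ}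
    (hR : ∀ v ∈ dilogPlane, ∏ k ∈ Finset.range N, qdilogOne (cyclicNode N v k - I) = R v) {w : ℂ}
    (hw : Complex.exp (2 * Real.pi * w) ≠ 1 ∨ w ∈ slitPlaneOne)
    (hlim : w ∉ dilogPlane → Tendsto (fun δ : ℝ => R (w - δ * I)) (𝓝[>] 0) (𝓝 (R w))) :
    ∏ k ∈ Finset.range N, qdilogOne (cyclicNode N w k - I) = R w := by
  by_cases h : w ∈ dilogPlane
  · exact hR w h
  · obtain ⟨n, _, hn⟩ := exists_of_notMem_dilogPlane h
    refine tendsto_nhds_unique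
      ((continuousAt_prod_qdilogOne hN hw).tendsto.comp (tendsto_sub_ofReal_mul_I w))
      ((hlim h).congr' ?_)
    filter_upwards [eventually_sub_mem_dilogPlane hn] with δ hδ using (hR _ hδ).symm

open Classical in
/-- The holomorphic logarithm of `Φ₁` on the plane without the rays `[0, ∞) + in`, `n ≠ 0`: the
integral in the strip `|Im w| < 1` and the closed form elsewhere. -/
noncomputable def logQDilogOneCont (w : ℂ) : ℂ :=
  if |w.im| < 1 then logQDilogOne w else dilogLogQDilogOne w

theorem logQDilogOneCont_of_mem {w : ℂ} (hw : w ∈ dilogPlane) :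
    logQDilogOneCont w = dilogLogQDilogOne w := by
  rw [logQDilogOneCont]
  split_ifs with h
  · exact logQDilogOne_eq_dilogLogQDilogOne h hw
  · rfl

theorem logQDilogOneCont_of_abs_im_lt {w : ℂ} (hw : |w.im| < 1) :
    logQDilogOneCont w = logQDilogOne w := if_pos hw

theorem mem_dilogPlane_of_mem_slitPlaneOne {w : ℂ} (hw : w ∈ slitPlaneOne) (h : ¬ |w.im| < 1) :
    w ∈ dilogPlane := by
  intro n hre him
  refine hw n ?_ hre him
  rintro rfl
  simp [him] at h

theorem differentiableAt_logQDilogOneCont {w : ℂ} (hw : w ∈ slitPlaneOne) :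
    DifferentiableAt ℂ logQDilogOneCont w := by
  by_cases h : |w.im| < 1
  · refine (hasDerivAt_logQDilogOne_integral h).differentiableAt.congr_of_eventuallyEq ?_
    filter_upwards [(isOpen_abs_im_sub_lt 0).mem_nhds (by simpa using h)] with v hv
    exact logQDilogOneCont_of_abs_im_lt (by simpa using hv)
  · have hd := mem_dilogPlane_of_mem_slitPlaneOne hw h
    refine (hasDerivAt_dilogLogQDilogOne hd).differentiableAt.congr_of_eventuallyEq ?_
    filter_upwards [isOpen_dilogPlane.mem_nhds hd] with v hv using logQDilogOneCont_of_mem hv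

theorem isLogQDilogOne_logQDilogOneCont : IsLogQDilogOne logQDilogOneCont where
  differentiableOn _ hw := (differentiableAt_logQDilogOneCont hw).differentiableWithinAt
  exp_eq w hw := by
    have hq : qdilog 1 w = qdilogOne w := by
      have hnode : qdilogNode 1 w 0 = w := by simp [qdilogNode]
      have h := qdilog_eq_prod (N := 1) le_rfl (x := w) fun j hj => by
        obtain rfl : j = 0 := by simpa using hj
        rw [hnode]
        by_contra hc
        rw [not_or, not_not, not_lt] at hc
        have h0 := eq_zero_of_exp_cyclicNode_eq_one one_ne_zero (Or.inr hw) one_pos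
          (by simpa [cyclicNode] using hc.1)
        have := hc.2
        rw [h0.1] at this
        norm_num at this
      simpa [hnode] using h
    rw [hq]
    by_cases h : |w.im| < 1
    · rw [logQDilogOneCont_of_abs_im_lt h, qdilogOne_eq_exp_logQDilogOne h]
    · have hd := mem_dilogPlane_of_mem_slitPlaneOne hw h
      rw [logQDilogOneCont_of_mem hd, qdilogOne_eq_exp hd]
  eq_exponent w hw := by
    have h : |w.im| < 1 := by
      have := (mem_qdilogStrip_one_div one_pos).1
        (by simpa using hw : w ∈ qdilogStrip (1 / (1 : ℝ)))
      norm_num at this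
      exact this
    rw [logQDilogOneCont_of_abs_im_lt h, qdilogExponent_one h]

theorem prod_qdilogOne_eq_dilog {N : ℕ} (hN : N ≠ 0) {w : ℂ}
    (hw : Complex.exp (2 * Real.pi * w) ≠ 1) :
    ∏ k ∈ Finset.range N, qdilogOne (cyclicNode N w k - I) =
      Complex.exp (I / (2 * Real.pi * N) * dilog (Complex.exp (2 * Real.pi * w)) +
        (1 + I * w / N) * Complex.log (1 - Complex.exp (2 * Real.pi * w)) -
          logCyclicDilog N w) := by
  refine prod_qdilogOne_eq_of_tendsto hN (R := fun w =>
    Complex.exp (I / (2 * Real.pi * N) * dilog (Complex.exp (2 * Real.pi * w)) +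
        (1 + I * w / N) * Complex.log (1 - Complex.exp (2 * Real.pi * w)) -
          logCyclicDilog N w)) (fun v hv => prod_qdilogOne_eq_exp hN hv) (Or.inl hw) fun _ => ?_
  have hlin : Continuous fun w : ℂ => 1 + I * w / N := by fun_prop
  exact ((((tendsto_dilog_exp_lower hw).const_mul _).add
    (((hlin.tendsto w).comp (tendsto_sub_ofReal_mul_I w)).mul
      (tendsto_log_one_sub_exp_lower hw))).sub (tendsto_logCyclicDilog_lower hN (Or.inl hw))).cexp

theorem prod_qdilogOne_eq_logQDilogOneCont {N : ℕ} (hN : N ≠ 0) {w : ℂ} (hw : w ∈ slitPlaneOne) :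
    ∏ k ∈ Finset.range N, qdilogOne (cyclicNode N w k - I) =
      (1 - Complex.exp (2 * Real.pi * w)) *
        Complex.exp (1 / N * logQDilogOneCont w - logCyclicDilog N w) := by
  refine prod_qdilogOne_eq_of_tendsto hN (R := fun w => (1 - Complex.exp (2 * Real.pi * w)) *
    Complex.exp (1 / N * logQDilogOneCont w - logCyclicDilog N w)) (fun v hv => ?_) (Or.inr hw)
    fun _ => ?_
  · rw [prod_qdilogOne_eq_exp hN hv, logQDilogOneCont_of_mem hv, dilogLogQDilogOne]
    set l := Complex.log (1 - Complex.exp (2 * Real.pi * v)) with hl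
    rw [← Complex.exp_log (exp_two_pi_mul_ne_one hv), ← hl, ← Complex.exp_add]
    congr 1
    ring
  · have hexp : Continuous fun w : ℂ => 1 - Complex.exp (2 * Real.pi * w) := by fun_prop
    exact ((hexp.tendsto w).comp (tendsto_sub_ofReal_mul_I w)).mul
      ((((differentiableAt_logQDilogOneCont hw).continuousAt.tendsto.comp
        (tendsto_sub_ofReal_mul_I w)).const_mul _).sub
          (tendsto_logCyclicDilog_lower hN (Or.inr hw))).cexp

/-- With `s = √N`, `b = 1/s`, `Q = b + b⁻¹` and `q = e^{πib²}`. -/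
theorem mainTheorem6 (N : ℕ) (hN : 1 ≤ N) (s b Q q : ℂ)
    (hs : s = ((Real.sqrt N : ℝ) : ℂ)) (hb : b = 1 / s) (hQ : Q = b + b⁻¹)
    (hq : q = Complex.exp (Real.pi * Complex.I * b ^ 2)) :
    (∀ z : ℂ, Complex.exp (2 * Real.pi * s * z) ≠ 1 →
      qdilog b (z - Complex.I * Q / 2) =
        Complex.exp (Complex.I / (2 * Real.pi * s ^ 2) *
            dilog (Complex.exp (2 * Real.pi * s * z))) *
          (1 - Complex.exp (2 * Real.pi * s * z)) ^ (1 + Complex.I * z / s) /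
          cyclicDilog N (Complex.exp (2 * Real.pi * s * z / N)) (q ^ 2)) ∧
    ∃ L : ℂ → ℂ, IsLogQDilogOne L ∧
      ∀ z : ℂ, s * z ∈ slitPlaneOne →
        qdilog b (z - Complex.I * Q / 2) =
          (1 - Complex.exp (2 * Real.pi * s * z)) * Complex.exp (1 / s ^ 2 * L (s * z)) /
            cyclicDilog N (Complex.exp (2 * Real.pi * s * z / N)) (q ^ 2) := by
  have hN' : N ≠ 0 := by omega
  have hs2 : s ^ 2 = N := by rw [hs, ofReal_sqrt_natCast_sq]
  have hs0 : s ≠ 0 := by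
    rintro rfl
    have : (N : ℂ) = 0 := by rw [← hs2]; ring
    exact hN' (by exact_mod_cast this)
  have hq2 : q ^ 2 = Complex.exp (2 * Real.pi * I / N) := by
    rw [hq, ← Complex.exp_nat_mul, hb, div_pow, hs2]
    congr 1
    push_cast; ring
  rw [hq2, hs2, hQ, hb, hs]
  simp_rw [mul_assoc (2 * (Real.pi : ℂ)) _ _]
  refine ⟨fun z hz => ?_, logQDilogOneCont, isLogQDilogOne_logQDilogOneCont, fun z hz => ?_⟩
  · rw [qdilog_eq_prod_cyclicNode hN (Or.inl hz), prod_qdilogOne_eq_dilog hN' hz,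
      cyclicDilog_eq_exp hN' (Or.inl hz), Complex.exp_sub, Complex.exp_add,
      cpow_def_of_ne_zero (sub_ne_zero.2 hz.symm), ← hs, ← hs2]
    congr 3
    field_simp
  · rw [qdilog_eq_prod_cyclicNode hN (Or.inr hz), prod_qdilogOne_eq_logQDilogOneCont hN' hz,
      cyclicDilog_eq_exp hN' (Or.inr hz), Complex.exp_sub, mul_div_assoc]
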